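/- **Setting.** Let $K\ge 1$, $T\ge 2$, $\gamma\in(0,1)$ and $M>0$. A $K$-armed stochastic bandit generates i.i.d. reward vectors $(r_t(a))_{a\in[K]}$ with $|r_t(a)|\le M$ almost surely and means $\mu_a=\mathbb E[r_t(a)]$. Only $r_t=r_t(a_t)$ is observed when arm $a_t$ is pulled in round $t$, and $\mathrm{Regret}(T)=\sum_{t=1}^T(\max_a\mu_a-\mu_{a_t})$. **Algorithm (doubly-adaptive Thompson sampling, DATS).** Put $\kappa=\sqrt{48M^2K\,(2+2\sqrt{K/\gamma}+K/\gamma)/\gamma}$. First pull each arm once; then put $\mathcal A_1=[K]$ and $\pi_{1,a}=1/K$. In round $t=1,\dots,T$ pull $a_t\in\mathcal A_t$ with conditional probabilities $(\pi_{t,a})_{a\in\mathcal A_t}$ given the observed past. With $\bar r_{s-1,a}$ the average of all rewards of arm $a$ observed before round $s$ (initial pull included), compute for $a\in\mathcal A_t$ $$\hat\Gamma_{s,a}=\bar r_{s-1,a}+\mathbf 1(a_s=a)\frac{r_s-\bar r_{s-1,a}}{\pi_{s,a}}\ (s\le t),\quad \hat\mu_{t,a}=\frac{\sum_{s\le t}\sqrt{\pi_{s,a}}\,\hat\Gamma_{s,a}}{\sum_{s\le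 t}\sqrt{\pi_{s,a}}},\quad \hat\sigma^2_{t,a}=\frac{\sum_{s\le t}\pi_{s,a}\big[(\hat\Gamma_{s,a}-\hat\mu_{t,a})^2+1\big]}{\big(\sum_{s\le t}\sqrt{\pi_{s,a}}\big)^2}.$$ Let $\tilde r_{t+1,a}\sim\mathcal N(\hat\mu_{t,a},\kappa^2\hat\sigma^2_{t,a})$ be independent over $a$ given the past. Let $\mathcal A_{t+1}$ consist of those $a\in\mathcal A_t$ with $$\min_{a'\in\mathcal A_t}\Phi\Big(\frac{\hat\mu_{t,a}-\hat\mu_{t,a'}}{\kappa\sqrt{\hat\sigma^2_{t,a}+\hat\sigma^2_{t,a'}}}\Big)\ge\frac1T,$$ where $\Phi$ is the standard normal distribution function, and put, for $a\in\mathcal A_{t+1}$, $$\pi_{t+1,a}=(1-\gamma)\,\mathbb P\big(a=\arg\max_{a'\in\mathcal A_{t+1}}\tilde r_{t+1,a'}\mid\text{observed past}\big)+\frac{\gamma}{|\mathcal A_{t+1}|}.$$ **Theorem.** There is a constant $C$, depending only on $M$ and $\gamma$, such that for all $K\ge1$, all $T\ge2$ and every such bandit, the expected regret of DATS satisfies $$\mathbb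 E[\mathrm{Regret}(T)]\le C\,K^2\sqrt{T\log T}.$$ -/

import Mathlib

open MeasureTheory ProbabilityTheory Finset

namespace DATS

noncomputable section

/-! Rounds are numbered `0, 1, 2, …`. The data of a run on `K` arms consist of the rewards
`x₀ : Fin K → ℝ` of the initial pulls (one per arm), the pulled arms `act s` and the observed
rewards `rew s` of the rounds `s`. Every quantity "after `n` rounds" only uses the rounds
`s < n`. -/

/-- Sample average of the observed rewards of arm `a` after `n` rounds, initial pull included. -/
def sampleMean {K : ℕ} (x₀ : Fin K → ℝ) (act : ℕ → Fin K) (rew : ℕ → ℝ) (n : ℕ) (a : Fin K) : ℝ :=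
  (x₀ a + ∑ s ∈ range n, if act s = a then rew s else 0) /
    (1 + (#{s ∈ range n | act s = a} : ℝ))

/-- The efficient (doubly robust) score of arm `a` in round `s`, where `p` is the propensity score
of arm `a` in round `s`; its baseline is the sample average before that round. -/
def score {K : ℕ} (x₀ : Fin K → ℝ) (act : ℕ → Fin K) (rew : ℕ → ℝ) (s : ℕ) (a : Fin K)
    (p : ℝ) : ℝ :=
  sampleMean x₀ act rew s a +
    if act s = a then (rew s - sampleMean x₀ act rew s a) / p else 0

/-- The adaptively weighted doubly robust estimate after `n` rounds, for one arm with propensity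
scores `p s` and efficient scores `g s`. -/
def adrMean (p g : ℕ → ℝ) (n : ℕ) : ℝ :=
  (∑ s ∈ range n, √(p s) * g s) / ∑ s ∈ range n, √(p s)

/-- The estimated variance that belongs to `adrMean`, with its auxiliary `+ 1`. -/
def adrVar (p g : ℕ → ℝ) (n : ℕ) : ℝ :=
  (∑ s ∈ range n, p s * ((g s - adrMean p g n) ^ 2 + 1)) / (∑ s ∈ range n, √(p s)) ^ 2

/-- Arm elimination: of the eligible arms `A`, with sampling distributions `𝒩(m a, v a)`, those
arms are kept whose probability of beating `a'` is at least `1 / T` for every `a' ∈ A`. -/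
def keep {K : ℕ} (T : ℕ) (A : Finset (Fin K)) (m v : Fin K → ℝ) : Finset (Fin K) :=
  open Classical in
  {a ∈ A | ∀ a' ∈ A, 1 / (T : ℝ) ≤ cdf (gaussianReal 0 1) ((m a - m a') / √(v a + v a'))}

/-- The probability that arm `a` is the maximizer among the arms in `A`, when independent samples
are drawn from `𝒩(m b, v b)`, one for every arm `b`. -/
def argmaxProb {K : ℕ} (A : Finset (Fin K)) (m v : Fin K → ℝ) (a : Fin K) : ℝ :=
  (Measure.pi fun b : Fin K => gaussianReal (m b) (v b).toNNReal).real
    {x | ∀ b ∈ A, b ≠ a → x b < x a}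

/-- The set of eligible arms of round `n` and the propensity scores of round `n` (zero on the arms
that are not eligible), as computed from the data of the rounds `s < n`. The sampling distribution
of arm `a` after `n` rounds is `𝒩(m a, v a)`, where `m a` is the adaptively weighted doubly robust
estimate and `v a` is `κ ^ 2` times its estimated variance. -/
def stage {K : ℕ} (γ κ : ℝ) (T : ℕ) (x₀ : Fin K → ℝ) (act : ℕ → Fin K) (rew : ℕ → ℝ) :
    ℕ → Finset (Fin K) × (Fin K → ℝ)
  | 0 => (Finset.univ, fun _ => 1 / (K : ℝ))
  | n + 1 =>
    let p : Fin K → ℕ → ℝ := fun a s =>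
      if _h : s < n + 1 then (stage γ κ T x₀ act rew s).2 a else 0
    let g : Fin K → ℕ → ℝ := fun a s => score x₀ act rew s a (p a s)
    let m : Fin K → ℝ := fun a => adrMean (p a) (g a) (n + 1)
    let v : Fin K → ℝ := fun a => κ ^ 2 * adrVar (p a) (g a) (n + 1)
    let A : Finset (Fin K) := keep T (stage γ κ T x₀ act rew n).1 m v
    (A, fun a => if a ∈ A then (1 - γ) * argmaxProb A m v a + γ / (#A : ℝ) else 0)
termination_by n => n

/-- The propensity score of arm `a` in round `n`. -/
def propensity {K : ℕ} (γ κ : ℝ) (T : ℕ) (x₀ : Fin K → ℝ) (act : ℕ → Fin K) (rew : ℕ → ℝ)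
    (n : ℕ) (a : Fin K) : ℝ :=
  (stage γ κ T x₀ act rew n).2 a

/-- The factor by which the standard deviation of the sampling distributions is inflated, for
`K` arms with rewards in `[-M, M]` and exploration level `γ`. -/
def inflation (γ M : ℝ) (K : ℕ) : ℝ :=
  √(48 * M ^ 2 * K * (2 + 2 * √(K / γ) + K / γ) / γ)

/-- What has been observed before round `n`: the rewards of the initial pulls, and the pulled arm
and its reward in each round `s < n`. Here `r s ω a` is the reward of arm `a` in round `s`. -/
def history {K : ℕ} {Ω : Type*} (init : Ω → Fin K → ℝ) (r : ℕ → Ω → Fin K → ℝ)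
    (act : ℕ → Ω → Fin K) (n : ℕ) (ω : Ω) : (Fin K → ℝ) × (Fin n → Fin K × ℝ) :=
  (init ω, fun s => (act s ω, r s ω (act s ω)))

/-- On the probability space `(Ω, P)`, the arms `act t`, `t < T`, are pulled by doubly-adaptive
Thompson sampling with horizon `T`, exploration level `γ` and inflation factor `κ`, in the
stochastic bandit whose reward vectors have law `ν`.

The initial pulls take place in separate rounds, so their rewards are independent. In round `t` a
reward vector with law `ν` is generated independently of the observed past and of the arm that is
pulled in round `t`, and this arm is drawn, given the observed past, according to the propensity
scores. -/
structure IsRun {K : ℕ} {Ω : Type*} [MeasurableSpace Ω] (P : Measure Ω)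
    (ν : Measure (Fin K → ℝ)) (γ κ : ℝ) (T : ℕ) (init : Ω → Fin K → ℝ)
    (r : ℕ → Ω → Fin K → ℝ) (act : ℕ → Ω → Fin K) : Prop where
  measurable_init : Measurable init
  measurable_reward : ∀ t < T, Measurable (r t)
  measurable_act : ∀ t < T, Measurable (act t)
  law_init : P.map init = Measure.pi fun a => ν.map fun x => x a
  law_reward : ∀ t < T, P.map (r t) = ν
  indep_reward : ∀ t < T, IndepFun (fun ω => (history init r act t ω, act t ω)) (r t) P
  law_act : ∀ t < T, ∀ a : Fin K,
    P[Set.indicator {ω | act t ω = a} (fun _ => (1 : ℝ)) |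
        MeasurableSpace.comap (history init r act t) inferInstance] =ᵐ[P]
      fun ω => propensity γ κ T (init ω) (fun s => act s ω) (fun s => r s ω (act s ω)) t a

/-- The true mean reward of arm `a`. -/
def armMean {K : ℕ} (ν : Measure (Fin K → ℝ)) (a : Fin K) : ℝ := ∫ x, x a ∂ν

/-- The cumulative regret of the rounds `t < T`, with respect to always pulling a best arm. -/
def regret {K : ℕ} {Ω : Type*} (ν : Measure (Fin K → ℝ)) (T : ℕ) (act : ℕ → Ω → Fin K)
    (ω : Ω) : ℝ :=
  ∑ t ∈ range T, ((⨆ a, armMean ν a) - armMean ν (act t ω))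

end

end DATS

namespace DATS

noncomputable section

/-! ### Tails of the standard normal distribution -/

/-! The Thompson probabilities enter only through the exploration floor: an eligible arm has
propensity in `[γ / K, 1]`, any other arm has propensity `0`. The regret bound comes from
concentration and elimination.

Concentration: the doubly robust score is conditionally unbiased (`integral_mul_score_eq_zero`).
Weighted by `√p`, its deviation from the mean is at most `c = scoreBound`, because the factor `1 /
p` becomes `1 / √p`. An Azuma–Hoeffding argument bounds the sum of the first `n` deviations by `2 c
√(n log T)` outside an event of probability `2 / T ^ 2`. The union over `n < T` and all arms has
probability at most `2 K / T` and costs at most `4 M K` in expected regret.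

Elimination on the good event: the auxiliary `+ 1` bounds the estimated variance from below, and
`inflation` is large enough that each estimate errs by at most `√(log T / 3)` sampling standard
deviations (`abs_adrMean_sub_le`). Gaussian tail bounds now work in both directions. The best arm
beats every rival with probability at least `1 / T`, so it is never eliminated
(`best_mem_eligible`). An arm that survives the comparison with it has a gap of order `√(log T)`
standard deviations. These are of order `K ^ 2 / √n` (`adrVar_le`, `inflation_sq_mul_le`), except in
early rounds, where the trivial gap bound `2 M` is enough. Hence `gap_le_of_mem_eligible`, and
summing `1 / √n` gives the rate. The pulled arm is almost surely eligible (`IsRun.ae_act_mem`). -/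

lemma cdf_gaussian_le {x : ℝ} (hx : x ≤ 0) :
    cdf (gaussianReal 0 1) x ≤ Real.exp (-(x ^ 2 / 2)) := by
  have h := measure_le_le_exp_mul_mgf (μ := gaussianReal 0 1) (X := id) (t := x) x hx
    (integrable_exp_mul_gaussianReal x)
  rw [mgf_id_gaussianReal, ← Real.exp_add] at h
  rw [cdf_eq_real]
  refine (le_of_eq ?_).trans (h.trans (le_of_eq ?_))
  · rfl
  · congr 1
    push_cast
    ring

/-- The density on the unit interval `(x - 1, x]` is already large enough: there `y ^ 2 / 2 ≤ x ^ 2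
+ 1`, and `√(2π) ≤ 3`. The loss in the exponent is harmless, since it is only used at `x ^ 2 = 2 log
T / 3`. -/
lemma le_cdf_gaussian (x : ℝ) :
    Real.exp (-(x ^ 2 + 1)) / 3 ≤ cdf (gaussianReal 0 1) x := by
  have h1 : Real.exp (-(x ^ 2 + 1)) / 3 ≤ ∫ y in Set.Ioc (x - 1) x, gaussianPDFReal 0 1 y := by
    have : ∫ y in Set.Ioc (x - 1) x, Real.exp (-(x ^ 2 + 1)) / 3 = Real.exp (-(x ^ 2 + 1)) / 3 := by
      simp
    rw [← this]
    refine setIntegral_mono_on (by simp) (integrable_gaussianPDFReal 0 1).integrableOn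
      measurableSet_Ioc fun y hy => ?_
    rw [gaussianPDFReal_def]
    have h3 : √(2 * Real.pi * ((1 : NNReal) : ℝ)) ≤ 3 := by
      rw [Real.sqrt_le_left (by norm_num)]
      have := Real.pi_lt_four
      push_cast
      linarith
    have h4 : 0 < √(2 * Real.pi * ((1 : NNReal) : ℝ)) := by
      have := Real.pi_pos
      positivity
    rw [div_eq_inv_mul]
    refine mul_le_mul (inv_anti₀ h4 h3) (Real.exp_le_exp.2 ?_) (by positivity) (by positivity)
    have := hy.1
    have := hy.2
    push_cast
    nlinarith [sq_nonneg (x + 1)]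
  refine h1.trans ?_
  rw [cdf_eq_real, measureReal_def, gaussianReal_apply_eq_integral 0 one_ne_zero,
    ENNReal.toReal_ofReal (integral_nonneg fun y => gaussianPDFReal_nonneg 0 1 y)]
  exact setIntegral_mono_set (integrable_gaussianPDFReal 0 1).integrableOn
    (Filter.Eventually.of_forall fun y => gaussianPDFReal_nonneg 0 1 y)
    (LE.le.eventuallyLE Set.Ioc_subset_Iic_self)

lemma one_div_le_cdf_gaussian {T x : ℝ} (hT : 600 ≤ T) (hx : -√(2 * Real.log T / 3) ≤ x) :
    1 / T ≤ cdf (gaussianReal 0 1) x := by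
  have hT0 : 0 < T := by linarith
  have hL : 0 ≤ Real.log T := Real.log_nonneg (by linarith)
  refine le_trans ?_ ((le_cdf_gaussian _).trans
    (monotone_cdf _ hx))
  rw [neg_sq, Real.sq_sqrt (by positivity), le_div_iff₀ (by norm_num),
    ← Real.log_le_log_iff (by positivity) (by positivity), Real.log_exp, one_div_mul_eq_div,
    Real.log_div (by norm_num) hT0.ne']
  have h1 : Real.log (600 : ℝ) ≤ Real.log T := Real.log_le_log (by norm_num) hT
  -- The requirement is `T ^ (1 / 3) ≥ 3 e`, that is `T ≥ 27 e ^ 3 ≈ 542`; this is the origin of the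
  -- threshold `600`.
  have h2 : Real.log (600 : ℝ) ≥ 3 * (1 + Real.log 3) := by
    have : (3 : ℝ) * (1 + Real.log 3) = Real.log (Real.exp 3 * 27) := by
      rw [Real.log_mul (by positivity) (by norm_num), Real.log_exp,
        show (27 : ℝ) = 3 ^ 3 by norm_num, Real.log_pow]
      push_cast
      ring
    rw [this]
    refine Real.log_le_log (by positivity) ?_
    have h3 : Real.exp 3 = Real.exp 1 ^ 3 := by rw [← Real.exp_nat_mul]; norm_num
    have h4 := Real.exp_one_lt_d9
    have h5 : Real.exp 1 ^ 3 ≤ 2.72 ^ 3 := by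
      have := Real.exp_pos 1
      gcongr
      linarith
    rw [h3]
    norm_num at h5 ⊢
    linarith
  linarith

lemma neg_sqrt_le_of_one_div_le_cdf_gaussian {T x : ℝ} (hT : 1 ≤ T)
    (h : 1 / T ≤ cdf (gaussianReal 0 1) x) : -√(2 * Real.log T) ≤ x := by
  by_contra! hx
  have hL : 0 ≤ Real.log T := Real.log_nonneg hT
  have h0 := Real.sqrt_nonneg (2 * Real.log T)
  have h1 := h.trans (cdf_gaussian_le (by linarith : x ≤ 0))
  rw [← Real.log_le_log_iff (by positivity) (by positivity), Real.log_exp, one_div,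
    Real.log_inv] at h1
  have h2 := Real.sq_sqrt (by positivity : 0 ≤ 2 * Real.log T)
  nlinarith

/-! ### The recursion of the eligible arms and the propensity scores -/

section Recursion

variable {K : ℕ} (γ κ : ℝ) (T : ℕ) (x₀ : Fin K → ℝ) (act : ℕ → Fin K) (rew : ℕ → ℝ)

/-- The set of eligible arms of round `n`. -/
def eligible (n : ℕ) : Finset (Fin K) := (stage γ κ T x₀ act rew n).1

/-- The efficient score of arm `a` in round `s`, for the propensity scores of the algorithm. -/
def algScore (s : ℕ) (a : Fin K) : ℝ :=
  score x₀ act rew s a (propensity γ κ T x₀ act rew s a)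

/-- The mean of the sampling distribution of arm `a` after `n` rounds. -/
def samplingMean (n : ℕ) (a : Fin K) : ℝ :=
  adrMean (fun s => propensity γ κ T x₀ act rew s a)
    (fun s => algScore γ κ T x₀ act rew s a) n

/-- The variance of the sampling distribution of arm `a` after `n` rounds. -/
def samplingVar (n : ℕ) (a : Fin K) : ℝ :=
  κ ^ 2 * adrVar (fun s => propensity γ κ T x₀ act rew s a)
    (fun s => algScore γ κ T x₀ act rew s a) n

lemma adrMean_congr {p p' g g' : ℕ → ℝ} {n : ℕ} (hp : ∀ s < n, p s = p' s)
    (hg : ∀ s < n, g s = g' s) : adrMean p g n = adrMean p' g' n := by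
  unfold adrMean
  have h₁ : ∑ s ∈ range n, √(p s) * g s = ∑ s ∈ range n, √(p' s) * g' s :=
    Finset.sum_congr rfl fun s hs => by
      rw [hp s (Finset.mem_range.1 hs), hg s (Finset.mem_range.1 hs)]
  have h₂ : ∑ s ∈ range n, √(p s) = ∑ s ∈ range n, √(p' s) :=
    Finset.sum_congr rfl fun s hs => by rw [hp s (Finset.mem_range.1 hs)]
  rw [h₁, h₂]

lemma adrVar_congr {p p' g g' : ℕ → ℝ} {n : ℕ} (hp : ∀ s < n, p s = p' s)
    (hg : ∀ s < n, g s = g' s) : adrVar p g n = adrVar p' g' n := by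
  unfold adrVar
  rw [adrMean_congr hp hg]
  have h₁ : ∑ s ∈ range n, p s * ((g s - adrMean p' g' n) ^ 2 + 1) =
      ∑ s ∈ range n, p' s * ((g' s - adrMean p' g' n) ^ 2 + 1) :=
    Finset.sum_congr rfl fun s hs => by
      rw [hp s (Finset.mem_range.1 hs), hg s (Finset.mem_range.1 hs)]
  have h₂ : ∑ s ∈ range n, √(p s) = ∑ s ∈ range n, √(p' s) :=
    Finset.sum_congr rfl fun s hs => by rw [hp s (Finset.mem_range.1 hs)]
  rw [h₁, h₂]

/-- The guard `s < n + 1` in `stage` only serves termination. It disappears here because estimates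
after `n + 1` rounds read no later propensities. -/
lemma stage_succ (n : ℕ) :
    stage γ κ T x₀ act rew (n + 1) =
      (keep T (eligible γ κ T x₀ act rew n) (samplingMean γ κ T x₀ act rew (n + 1))
        (samplingVar γ κ T x₀ act rew (n + 1)),
      fun a => if a ∈ keep T (eligible γ κ T x₀ act rew n)
          (samplingMean γ κ T x₀ act rew (n + 1)) (samplingVar γ κ T x₀ act rew (n + 1)) then
        (1 - γ) * argmaxProb (keep T (eligible γ κ T x₀ act rew n)
          (samplingMean γ κ T x₀ act rew (n + 1)) (samplingVar γ κ T x₀ act rew (n + 1)))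
          (samplingMean γ κ T x₀ act rew (n + 1)) (samplingVar γ κ T x₀ act rew (n + 1)) a +
          γ / (#(keep T (eligible γ κ T x₀ act rew n)
          (samplingMean γ κ T x₀ act rew (n + 1)) (samplingVar γ κ T x₀ act rew (n + 1))) : ℝ)
        else 0) := by
  have hm : samplingMean γ κ T x₀ act rew (n + 1) = fun a => adrMean
      (fun s => if _h : s < n + 1 then (stage γ κ T x₀ act rew s).2 a else 0)
      (fun s => score x₀ act rew s a
        (if _h : s < n + 1 then (stage γ κ T x₀ act rew s).2 a else 0)) (n + 1) := by
    funext a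
    refine adrMean_congr (fun s hs => ?_) fun s hs => ?_ <;>
      simp [propensity, algScore, hs]
  have hv : samplingVar γ κ T x₀ act rew (n + 1) = fun a => κ ^ 2 * adrVar
      (fun s => if _h : s < n + 1 then (stage γ κ T x₀ act rew s).2 a else 0)
      (fun s => score x₀ act rew s a
        (if _h : s < n + 1 then (stage γ κ T x₀ act rew s).2 a else 0)) (n + 1) := by
    funext a
    unfold samplingVar
    congr 1
    refine adrVar_congr (fun s hs => ?_) fun s hs => ?_ <;>
      simp [propensity, algScore, hs]
  rw [hm, hv, stage]
  rfl

lemma eligible_zero : eligible γ κ T x₀ act rew 0 = Finset.univ := by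
  rw [eligible, stage]

lemma mem_eligible_succ {n : ℕ} {a : Fin K} :
    a ∈ eligible γ κ T x₀ act rew (n + 1) ↔ a ∈ eligible γ κ T x₀ act rew n ∧
      ∀ b ∈ eligible γ κ T x₀ act rew n, 1 / (T : ℝ) ≤ cdf (gaussianReal 0 1)
        ((samplingMean γ κ T x₀ act rew (n + 1) a - samplingMean γ κ T x₀ act rew (n + 1) b) /
          √(samplingVar γ κ T x₀ act rew (n + 1) a + samplingVar γ κ T x₀ act rew (n + 1) b)) := by
  conv_lhs => rw [eligible, stage_succ]
  simp [keep]

lemma eligible_antitone : Antitone (eligible γ κ T x₀ act rew) :=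
  antitone_nat_of_succ_le fun _ _ ha => ((mem_eligible_succ γ κ T x₀ act rew).1 ha).1

variable {γ}

lemma propensity_of_notMem {n : ℕ} {a : Fin K} (ha : a ∉ eligible γ κ T x₀ act rew n) :
    propensity γ κ T x₀ act rew n a = 0 := by
  cases n with
  | zero => simp [eligible_zero] at ha
  | succ n =>
    rw [eligible, stage_succ] at ha
    rw [propensity, stage_succ]
    exact if_neg ha

lemma propensity_of_mem (hγ₀ : 0 < γ) (hγ₁ : γ < 1) {n : ℕ} {a : Fin K}
    (ha : a ∈ eligible γ κ T x₀ act rew n) :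
    γ / K ≤ propensity γ κ T x₀ act rew n a ∧ propensity γ κ T x₀ act rew n a ≤ 1 := by
  have hK : (1 : ℝ) ≤ K := by exact_mod_cast a.pos
  cases n with
  | zero =>
    rw [propensity, stage]
    refine ⟨div_le_div_of_nonneg_right hγ₁.le (by linarith), ?_⟩
    rw [div_le_one (by linarith)]
    exact hK
  | succ n =>
    rw [eligible, stage_succ] at ha
    rw [propensity, stage_succ]
    simp only [] at ha ⊢
    rw [if_pos ha]
    generalize keep T (eligible γ κ T x₀ act rew n)
        (samplingMean γ κ T x₀ act rew (n + 1)) (samplingVar γ κ T x₀ act rew (n + 1)) = A at ha ⊢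
    have h0 : 0 ≤ argmaxProb A (samplingMean γ κ T x₀ act rew (n + 1))
      (samplingVar γ κ T x₀ act rew (n + 1)) a := measureReal_nonneg
    have h1 : argmaxProb A (samplingMean γ κ T x₀ act rew (n + 1))
      (samplingVar γ κ T x₀ act rew (n + 1)) a ≤ 1 := measureReal_le_one
    have hA : (1 : ℝ) ≤ #A := by exact_mod_cast Finset.card_pos.2 ⟨a, ha⟩
    have hA' : (#A : ℝ) ≤ K := by
      have := Finset.card_le_univ A
      rw [Fintype.card_fin] at this
      exact_mod_cast this
    have h2 : γ / K ≤ γ / #A := by gcongr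
    have h3 : γ / #A ≤ γ := div_le_self hγ₀.le hA
    constructor <;> nlinarith

/-- The form in which the floor enters the concentration argument: an eliminated arm contributes
nothing because of the weight `√p = 0`, so its sums can run over all rounds. -/
lemma propensity_eq_zero_or (hγ₀ : 0 < γ) (hγ₁ : γ < 1) (n : ℕ) (a : Fin K) :
    propensity γ κ T x₀ act rew n a = 0 ∨
      γ / K ≤ propensity γ κ T x₀ act rew n a ∧ propensity γ κ T x₀ act rew n a ≤ 1 := by
  by_cases ha : a ∈ eligible γ κ T x₀ act rew n
  · exact .inr (propensity_of_mem κ T x₀ act rew hγ₀ hγ₁ ha)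
  · exact .inl (propensity_of_notMem κ T x₀ act rew ha)

end Recursion

/-! ### Deterministic bounds -/

lemma abs_sampleMean_le {K : ℕ} {x₀ : Fin K → ℝ} {act : ℕ → Fin K} {rew : ℕ → ℝ} {n : ℕ}
    {a : Fin K} {M : ℝ} (h₀ : |x₀ a| ≤ M) (hr : ∀ s < n, |rew s| ≤ M) :
    |sampleMean x₀ act rew n a| ≤ M := by
  unfold sampleMean
  have hc : (0 : ℝ) < 1 + (#{s ∈ range n | act s = a} : ℝ) := by positivity
  rw [abs_div, abs_of_pos hc, div_le_iff₀ hc]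
  calc _ ≤ |x₀ a| + |∑ s ∈ range n, if act s = a then rew s else 0| := abs_add_le _ _
    _ ≤ |x₀ a| + ∑ s ∈ range n, |if act s = a then rew s else 0| := by
        gcongr
        exact Finset.abs_sum_le_sum_abs _ _
    _ ≤ M + ∑ s ∈ range n, if act s = a then M else 0 := by
        gcongr with s hs
        split_ifs
        · exact hr s (Finset.mem_range.1 hs)
        · simp
    _ = _ := by
        rw [← Finset.sum_filter, Finset.sum_const, nsmul_eq_mul]
        ring

lemma abs_sqrt_mul_score_sub_le {K : ℕ} {x₀ : Fin K → ℝ} {act : ℕ → Fin K} {rew : ℕ → ℝ} {s : ℕ}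
    {a : Fin K} {M μ p q : ℝ} (h₀ : |x₀ a| ≤ M) (hr : ∀ t ≤ s, |rew t| ≤ M) (hμ : |μ| ≤ M)
    (hq : 0 < q) (hp : p = 0 ∨ q ≤ p ∧ p ≤ 1) :
    |√p * (score x₀ act rew s a p - μ)| ≤ 2 * M * (1 + 1 / √q) := by
  have hM : 0 ≤ M := (abs_nonneg _).trans hμ
  rcases hp with rfl | ⟨hqp, hp1⟩
  · simp
    positivity
  have hp0 : 0 < p := hq.trans_le hqp
  have hb := abs_sampleMean_le (act := act) h₀ fun t ht => hr t (le_of_lt ht)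
  have hs := hr s le_rfl
  have hsp : √p ≤ 1 := Real.sqrt_le_one.2 hp1
  have hsp0 : 0 < √p := Real.sqrt_pos.2 hp0
  have hsq : 1 / √p ≤ 1 / √q := by
    have := Real.sqrt_pos.2 hq
    gcongr
  unfold score
  rw [abs_le] at hb hs hμ
  have e1 : |√p * (sampleMean x₀ act rew s a - μ)| ≤ 2 * M := by
    rw [abs_mul, abs_of_pos hsp0]
    have : |sampleMean x₀ act rew s a - μ| ≤ 2 * M := abs_le.2 ⟨by linarith, by linarith⟩
    nlinarith [abs_nonneg (sampleMean x₀ act rew s a - μ)]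
  have e2 : |√p * if act s = a then (rew s - sampleMean x₀ act rew s a) / p else 0| ≤
      2 * M * (1 / √q) := by
    split_ifs
    · have : √p * ((rew s - sampleMean x₀ act rew s a) / p) =
          (rew s - sampleMean x₀ act rew s a) * (1 / √p) := by
        have := Real.mul_self_sqrt hp0.le
        field_simp
        rw [sq, this, mul_comm]
      rw [this, abs_mul, abs_of_pos (by positivity : 0 < 1 / √p)]
      have : |rew s - sampleMean x₀ act rew s a| ≤ 2 * M := abs_le.2 ⟨by linarith, by linarith⟩
      gcongr
    · simp
      positivity
  calc _ = |√p * (sampleMean x₀ act rew s a - μ) +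
        √p * if act s = a then (rew s - sampleMean x₀ act rew s a) / p else 0| := by
        congr 1
        ring
    _ ≤ _ := abs_add_le _ _
    _ ≤ 2 * M + 2 * M * (1 / √q) := add_le_add e1 e2
    _ = _ := by ring

/-! ### Error and estimated variance of the weighted estimate of one arm -/

section Adr

variable {p g : ℕ → ℝ} {n : ℕ} {q c μ L κ : ℝ}

lemma mul_sqrt_le_sum_sqrt (hpq : ∀ s < n, q ≤ p s) : n * √q ≤ ∑ s ∈ range n, √(p s) := by
  have := Finset.card_nsmul_le_sum (range n) (fun s => √(p s)) (√q)
    fun s hs => Real.sqrt_le_sqrt (hpq s (Finset.mem_range.1 hs))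
  simpa using this

lemma sum_sqrt_pos (hn : 0 < n) (hq : 0 < q) (hpq : ∀ s < n, q ≤ p s) :
    0 < ∑ s ∈ range n, √(p s) :=
  lt_of_lt_of_le (by have := Real.sqrt_pos.2 hq; positivity) (mul_sqrt_le_sum_sqrt hpq)

lemma adrMean_sub (hW : 0 < ∑ s ∈ range n, √(p s)) :
    adrMean p g n - μ = (∑ s ∈ range n, √(p s) * (g s - μ)) / ∑ s ∈ range n, √(p s) := by
  rw [adrMean, eq_div_iff hW.ne', sub_mul, div_mul_cancel₀ _ hW.ne']
  simp only [mul_sub, Finset.sum_sub_distrib, ← Finset.sum_mul]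
  ring

/-- Only the auxiliary `+ 1` in the variance is used; the squares are dropped. -/
lemma le_adrVar (hq : 0 < q) (hpq : ∀ s < n, q ≤ p s) :
    n * q / (∑ s ∈ range n, √(p s)) ^ 2 ≤ adrVar p g n := by
  unfold adrVar
  gcongr
  have := Finset.card_nsmul_le_sum (range n) (fun s => p s * ((g s - adrMean p g n) ^ 2 + 1)) q
    fun s hs => by
      have := hpq s (Finset.mem_range.1 hs)
      nlinarith [sq_nonneg (g s - adrMean p g n),
        mul_nonneg (hq.le.trans this) (sq_nonneg (g s - adrMean p g n))]
  simpa using this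

lemma adrVar_pos (hn : 0 < n) (hq : 0 < q) (hpq : ∀ s < n, q ≤ p s) : 0 < adrVar p g n := by
  have := sum_sqrt_pos hn hq hpq
  exact lt_of_lt_of_le (by positivity) (le_adrVar hq hpq)

lemma abs_adrMean_sub_le (hn : 0 < n) (hq : 0 < q) (hpq : ∀ s < n, q ≤ p s)
    (hL : 0 ≤ L) (hκ : 12 * c ^ 2 ≤ κ ^ 2 * q)
    (hS : |∑ s ∈ range n, √(p s) * (g s - μ)| ≤ 2 * c * √(n * L)) :
    |adrMean p g n - μ| ≤ √(L / 3) * √(κ ^ 2 * adrVar p g n) := by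
  have hW := sum_sqrt_pos hn hq hpq
  rw [adrMean_sub hW, abs_div, abs_of_pos hW, ← Real.sqrt_mul (by positivity)]
  apply Real.le_sqrt_of_sq_le
  have h1 := le_adrVar (g := g) hq hpq
  rw [div_pow]
  calc _ ≤ (2 * c * √(n * L)) ^ 2 / (∑ s ∈ range n, √(p s)) ^ 2 := by gcongr
    _ = L / 3 * ((12 * c ^ 2) * (n / (∑ s ∈ range n, √(p s)) ^ 2)) := by
        rw [mul_pow, Real.sq_sqrt (by positivity)]
        ring
    _ ≤ L / 3 * ((κ ^ 2 * q) * (n / (∑ s ∈ range n, √(p s)) ^ 2)) := by gcongr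
    _ = L / 3 * (κ ^ 2 * (n * q / (∑ s ∈ range n, √(p s)) ^ 2)) := by ring
    _ ≤ _ := by gcongr

/-- Once `L ≤ n q`, one has `√(n L) ≤ n √q ≤ ∑ √p`, so the estimate is within `2 c` of `μ`.
Recentring the scores at the estimate then raises their weighted bound from `c` to at most `3 c`. -/
lemma adrVar_le (hn : 0 < n) (hq : 0 < q) (hpq : ∀ s < n, q ≤ p s) (hp1 : ∀ s < n, p s ≤ 1)
    (hc : 0 ≤ c) (hg : ∀ s < n, |√(p s) * (g s - μ)| ≤ c) (hLn : L ≤ n * q)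
    (hS : |∑ s ∈ range n, √(p s) * (g s - μ)| ≤ 2 * c * √(n * L)) :
    adrVar p g n ≤ (9 * c ^ 2 + 1) / (n * q) := by
  have hW := sum_sqrt_pos hn hq hpq
  have hW' := mul_sqrt_le_sum_sqrt hpq
  have hsq := Real.sqrt_pos.2 hq
  have hn' : (0 : ℝ) < n := by exact_mod_cast hn
  have hm : |adrMean p g n - μ| ≤ 2 * c := by
    rw [adrMean_sub hW, abs_div, abs_of_pos hW, div_le_iff₀ hW]
    refine hS.trans ?_
    gcongr
    refine le_trans ?_ hW'
    rw [Real.sqrt_le_left (by positivity), mul_pow, Real.sq_sqrt hq.le]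
    nlinarith
  have hterm : ∀ s ∈ range n, p s * ((g s - adrMean p g n) ^ 2 + 1) ≤ 9 * c ^ 2 + 1 := by
    intro s hs
    have hs := Finset.mem_range.1 hs
    have hps := hq.le.trans (hpq s hs)
    have h1 : |√(p s) * (g s - adrMean p g n)| ≤ 3 * c := by
      calc _ = |√(p s) * (g s - μ) - √(p s) * (adrMean p g n - μ)| := by congr 1; ring
        _ ≤ |√(p s) * (g s - μ)| + |√(p s) * (adrMean p g n - μ)| := abs_sub _ _
        _ ≤ c + 1 * (2 * c) := by
          refine add_le_add (hg s hs) ?_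
          rw [abs_mul, abs_of_nonneg (Real.sqrt_nonneg _)]
          have := Real.sqrt_le_one.2 (hp1 s hs)
          gcongr
        _ = _ := by ring
    have h2 := sq_le_sq' (abs_le.1 h1).1 (abs_le.1 h1).2
    rw [mul_pow, Real.sq_sqrt hps] at h2
    linarith [hp1 s hs]
  unfold adrVar
  have hsum := Finset.sum_le_card_nsmul _ _ _ hterm
  rw [Finset.card_range, nsmul_eq_mul] at hsum
  calc _ ≤ n * (9 * c ^ 2 + 1) / (n * √q) ^ 2 := by gcongr
    _ = _ := by
      rw [mul_pow, Real.sq_sqrt hq.le]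
      field_simp

end Adr

/-! ### The regret on the event that all estimates are accurate -/

/-- A bound on the weighted deviations `√(p s) * (g s - μ)` of the efficient scores. -/
def scoreBound (γ M : ℝ) (K : ℕ) : ℝ := 2 * M * (1 + 1 / √(γ / K))

/-- The constant in the bound on the gap of an eligible arm. -/
def gapConst (γ M : ℝ) : ℝ := 4 * (√(240 * M ^ 2 * (144 * M ^ 2 + 1)) / γ ^ 2) + 2 * M / √γ

/-! ### Comparison of the constants -/

section Constants

variable {γ M : ℝ} {K : ℕ}

lemma scoreBound_nonneg (hM : 0 ≤ M) : 0 ≤ scoreBound γ M K := by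
  unfold scoreBound
  positivity

lemma one_div_sqrt_div : 1 / √(γ / K) = √(K / γ) := by
  rw [one_div, ← Real.sqrt_inv, inv_div]

lemma inflation_sq (hγ : 0 < γ) : inflation γ M K ^ 2 =
    48 * M ^ 2 * (1 + (1 + √(K / γ)) ^ 2) * (K / γ) := by
  unfold inflation
  rw [Real.sq_sqrt (by positivity)]
  have h := Real.sq_sqrt (by positivity : (0 : ℝ) ≤ K / γ)
  rw [add_sq, h]
  ring

lemma scoreBound_sq_le (hγ : 0 < γ) (hK : 1 ≤ K) :
    12 * scoreBound γ M K ^ 2 ≤ inflation γ M K ^ 2 * (γ / K) := by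
  have hK' : (0 : ℝ) < K := by exact_mod_cast hK
  rw [inflation_sq hγ, scoreBound, one_div_sqrt_div, mul_assoc (48 * M ^ 2 * _),
    show (K : ℝ) / γ * (γ / K) = 1 by field_simp]
  nlinarith [sq_nonneg M]

lemma one_le_div (hγ : 0 < γ) (hγ₁ : γ < 1) (hK : 1 ≤ K) : 1 ≤ (K : ℝ) / γ := by
  have hK' : (1 : ℝ) ≤ K := by exact_mod_cast hK
  rw [le_div_iff₀ hγ]
  linarith

/-- The source of the factor `K ^ 2`. Since `K / γ ≥ 1`, the squared inflation is `O((K / γ) ^ 2)`,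
the squared score bound is `O(K / γ)`, and the floor contributes one more `K / γ`; the root of the
fourth power remains. -/
lemma inflation_sq_mul_le (hγ : 0 < γ) (hγ₁ : γ < 1) (hK : 1 ≤ K) {n : ℝ} (hn : 0 < n) :
    √(inflation γ M K ^ 2 * ((9 * scoreBound γ M K ^ 2 + 1) / (n * (γ / K)))) ≤
      √(240 * M ^ 2 * (144 * M ^ 2 + 1)) / γ ^ 2 * K ^ 2 * (1 / √n) := by
  have hK' : (0 : ℝ) < K := by exact_mod_cast hK
  rw [inflation_sq hγ, scoreBound, one_div_sqrt_div]
  have hx := one_le_div hγ hγ₁ hK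
  have hx2 := Real.sq_sqrt (zero_le_one.trans hx)
  have hx1 : 1 ≤ √((K : ℝ) / γ) := Real.one_le_sqrt.2 hx
  set x := √((K : ℝ) / γ)
  have e : √(240 * M ^ 2 * (144 * M ^ 2 + 1)) / γ ^ 2 * K ^ 2 * (1 / √n) =
      √(240 * M ^ 2 * (144 * M ^ 2 + 1) * (K / γ) ^ 4 * (1 / n)) := by
    rw [Real.sqrt_mul (by positivity) (1 / n), Real.sqrt_mul (by positivity) ((K / γ) ^ 4),
      Real.sqrt_div zero_le_one, Real.sqrt_one,
      show ((K : ℝ) / γ) ^ 4 = ((K / γ) ^ 2) ^ 2 by ring, Real.sqrt_sq (by positivity)]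
    ring
  rw [e]
  apply Real.sqrt_le_sqrt
  have e2 : (9 * (2 * M * (1 + x)) ^ 2 + 1) / (n * (γ / K)) =
      (36 * M ^ 2 * (1 + x) ^ 2 + 1) * (K / γ) * (1 / n) := by
    field_simp
    ring
  rw [e2]
  have h4 : (1 + x) ^ 2 ≤ 4 * (K / γ) := by rw [← hx2]; nlinarith
  have h5 : 1 + (1 + x) ^ 2 ≤ 5 * (K / γ) := by linarith
  have h6 : 36 * M ^ 2 * (1 + x) ^ 2 + 1 ≤ (144 * M ^ 2 + 1) * (K / γ) := by
    nlinarith [sq_nonneg M]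
  calc _ ≤ 48 * M ^ 2 * (5 * (K / γ)) * (K / γ) *
        ((144 * M ^ 2 + 1) * (K / γ) * (K / γ) * (1 / n)) := by gcongr
    _ = _ := by ring

/-- The second summand of `gapConst` exists for this case: early rounds, in which the variance bound
is not yet available. -/
lemma two_mul_le_gapConst (hγ : 0 < γ) (hM : 0 ≤ M) (hK : 1 ≤ K) {y : ℝ}
    (hy : √(γ / K) ≤ y) : 2 * M ≤ gapConst γ M * K ^ 2 * y := by
  have hK' : (1 : ℝ) ≤ K := by exact_mod_cast hK
  have hsK : 1 ≤ √(K : ℝ) := Real.one_le_sqrt.2 hK'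
  have hsγ := Real.sqrt_pos.2 hγ
  have h1 : 2 * M / √γ ≤ gapConst γ M := le_add_of_nonneg_left (by positivity)
  have h2 : 1 ≤ (K : ℝ) ^ 2 / √K := by
    rw [le_div_iff₀ (by positivity), one_mul]
    have := Real.sq_sqrt (zero_le_one.trans hK')
    nlinarith
  calc 2 * M = 2 * M * 1 := by ring
    _ ≤ 2 * M * (K ^ 2 / √K) := by gcongr
    _ = 2 * M / √γ * K ^ 2 * √(γ / K) := by
      rw [Real.sqrt_div hγ.le]
      field_simp
    _ ≤ _ := by
      have : 0 ≤ gapConst γ M := le_trans (by positivity) h1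
      gcongr

end Constants

/-! ### Elimination when all deviations are small -/

section GoodEvent

variable {K T : ℕ} {γ M : ℝ} {x₀ : Fin K → ℝ} {act : ℕ → Fin K} {rew : ℕ → ℝ} {μ : Fin K → ℝ}

/-- The sum over the rounds `s < n` of the weighted deviations of the efficient scores of arm `a`
from `μ`. -/
def deviation (γ κ : ℝ) (T : ℕ) (x₀ : Fin K → ℝ) (act : ℕ → Fin K) (rew : ℕ → ℝ) (n : ℕ)
    (a : Fin K) (μ : ℝ) : ℝ :=
  ∑ s ∈ range n, √(propensity γ κ T x₀ act rew s a) * (algScore γ κ T x₀ act rew s a - μ)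

/-- Eliminated arms never return, so an arm eligible now has had the floor in every round so far. -/
lemma le_propensity_of_mem {κ : ℝ} (hγ₀ : 0 < γ) (hγ₁ : γ < 1) {n : ℕ} {a : Fin K}
    (ha : a ∈ eligible γ κ T x₀ act rew n) :
    ∀ s < n + 1, γ / K ≤ propensity γ κ T x₀ act rew s a ∧
      propensity γ κ T x₀ act rew s a ≤ 1 := fun _ hs =>
  propensity_of_mem κ T x₀ act rew hγ₀ hγ₁
    (eligible_antitone γ κ T x₀ act rew (Nat.lt_succ_iff.1 hs) ha)

lemma samplingVar_pos (hγ₀ : 0 < γ) (hγ₁ : γ < 1) (hM : 0 < M) {n : ℕ} {a : Fin K}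
    (ha : a ∈ eligible γ (inflation γ M K) T x₀ act rew n) :
    0 < samplingVar γ (inflation γ M K) T x₀ act rew (n + 1) a := by
  have hK' : (0 : ℝ) < K := by exact_mod_cast a.pos
  have hp := le_propensity_of_mem hγ₀ hγ₁ ha
  have := adrVar_pos (g := fun s => algScore γ (inflation γ M K) T x₀ act rew s a)
    n.succ_pos (by positivity : 0 < γ / K) fun s hs => (hp s hs).1
  unfold samplingVar
  rw [inflation_sq hγ₀]
  positivity

lemma abs_samplingMean_sub_le (hγ₀ : 0 < γ) (hγ₁ : γ < 1) (hT : 1 ≤ T)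
    {n : ℕ} {a : Fin K} (ha : a ∈ eligible γ (inflation γ M K) T x₀ act rew n)
    (hdev : |deviation γ (inflation γ M K) T x₀ act rew (n + 1) a (μ a)| ≤
      2 * scoreBound γ M K * √((n + 1 : ℕ) * Real.log T)) :
    |samplingMean γ (inflation γ M K) T x₀ act rew (n + 1) a - μ a| ≤
      √(Real.log T / 3) * √(samplingVar γ (inflation γ M K) T x₀ act rew (n + 1) a) := by
  have hK' : (0 : ℝ) < K := by exact_mod_cast a.pos
  have hL : 0 ≤ Real.log T := Real.log_nonneg (by exact_mod_cast hT)
  exact abs_adrMean_sub_le n.succ_pos (by positivity : 0 < γ / K)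
    (fun s hs => (le_propensity_of_mem hγ₀ hγ₁ ha s hs).1) hL (scoreBound_sq_le hγ₀ a.pos) hdev

lemma sqrt_add_sqrt_le {u v : ℝ} (hu : 0 ≤ u) (hv : 0 ≤ v) : √u + √v ≤ √2 * √(u + v) := by
  rw [← Real.sqrt_mul (by norm_num)]
  apply Real.le_sqrt_of_sq_le
  nlinarith [Real.sq_sqrt hu, Real.sq_sqrt hv, sq_nonneg (√u - √v)]

lemma sqrt_add_le_add_sqrt {u v : ℝ} (hu : 0 ≤ u) (hv : 0 ≤ v) : √(u + v) ≤ √u + √v := by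
  rw [Real.sqrt_le_left (by positivity)]
  nlinarith [Real.sq_sqrt hu, Real.sq_sqrt hv, mul_nonneg (Real.sqrt_nonneg u) (Real.sqrt_nonneg v)]

lemma best_mem_eligible (hγ₀ : 0 < γ) (hγ₁ : γ < 1) (hM : 0 < M) (hT : 600 ≤ T)
    (hdev : ∀ n < T, ∀ a, |deviation γ (inflation γ M K) T x₀ act rew n a (μ a)| ≤
      2 * scoreBound γ M K * √(n * Real.log T)) {i : Fin K} (hi : ∀ a, μ a ≤ μ i) :
    ∀ n < T, i ∈ eligible γ (inflation γ M K) T x₀ act rew n := by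
  intro n
  induction n with
  | zero => intro _; simp [eligible_zero]
  | succ n ih =>
    intro hn
    have hmem := ih (by omega)
    refine (mem_eligible_succ ..).2 ⟨hmem, fun b hb => ?_⟩
    have h1 := abs_samplingMean_sub_le hγ₀ hγ₁ (by omega) hmem (hdev (n + 1) hn i)
    have h2 := abs_samplingMean_sub_le hγ₀ hγ₁ (by omega) hb (hdev (n + 1) hn b)
    have hv1 := samplingVar_pos hγ₀ hγ₁ hM hmem
    have hv2 := samplingVar_pos hγ₀ hγ₁ hM hb
    apply one_div_le_cdf_gaussian (by exact_mod_cast hT)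
    rw [le_div_iff₀ (Real.sqrt_pos.2 (by positivity))]
    -- The two errors add to `√(log T / 3)` times the sum of the standard deviations. Passing to the
    -- root of the summed variances costs `√2`, which yields exactly the `√(2 log T / 3)` of the
    -- lower tail bound.
    have h3 := mul_le_mul_of_nonneg_left (sqrt_add_sqrt_le hv1.le hv2.le)
      (Real.sqrt_nonneg (Real.log T / 3))
    rw [← mul_assoc, mul_add, ← Real.sqrt_mul' (Real.log T / 3) (by norm_num : (0 : ℝ) ≤ 2)] at h3
    rw [show 2 * Real.log (T : ℝ) / 3 = Real.log T / 3 * 2 by ring]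
    have := hi b
    rw [abs_le] at h1 h2
    linarith

lemma gap_le_of_mem_eligible (hγ₀ : 0 < γ) (hγ₁ : γ < 1) (hM : 0 < M) (hT : 600 ≤ T)
    (hx₀ : ∀ a, |x₀ a| ≤ M) (hrew : ∀ s < T, |rew s| ≤ M) (hμ : ∀ a, |μ a| ≤ M)
    (hdev : ∀ n < T, ∀ a, |deviation γ (inflation γ M K) T x₀ act rew n a (μ a)| ≤
      2 * scoreBound γ M K * √(n * Real.log T)) {i : Fin K} (hi : ∀ a, μ a ≤ μ i)
    {n : ℕ} (hn : n + 1 < T) {a : Fin K}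
    (ha : a ∈ eligible γ (inflation γ M K) T x₀ act rew (n + 1)) :
    μ i - μ a ≤ gapConst γ M * K ^ 2 * √(Real.log T / (n + 1 : ℕ)) := by
  have hK : 1 ≤ K := a.pos
  have hK' : (0 : ℝ) < K := by exact_mod_cast hK
  have hL : 0 ≤ Real.log T := Real.log_nonneg (by exact_mod_cast (by omega : 1 ≤ T))
  have hn' : (0 : ℝ) < (n + 1 : ℕ) := by positivity
  have hq : 0 < γ / K := by positivity
  -- `hlarge` is the condition under which `adrVar_le` applies; otherwise the trivial bound `2 M` is
  -- already of the claimed order.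
  rcases le_total (((n + 1 : ℕ) : ℝ) * (γ / K)) (Real.log T) with hsmall | hlarge
  · have h1 := abs_le.1 (hμ i)
    have h2 := abs_le.1 (hμ a)
    refine le_trans (by linarith : μ i - μ a ≤ 2 * M)
      (two_mul_le_gapConst hγ₀ hM.le hK (Real.sqrt_le_sqrt ?_))
    rw [le_div_iff₀ hn']
    linarith
  have hi_mem := best_mem_eligible hγ₀ hγ₁ hM hT hdev hi n (by omega)
  obtain ⟨ha_mem, hbeat⟩ := (mem_eligible_succ ..).1 ha
  have hbeat := hbeat i hi_mem
  have hv : ∀ b ∈ eligible γ (inflation γ M K) T x₀ act rew n,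
      √(samplingVar γ (inflation γ M K) T x₀ act rew (n + 1) b) ≤
        √(240 * M ^ 2 * (144 * M ^ 2 + 1)) / γ ^ 2 * K ^ 2 * (1 / √(n + 1 : ℕ)) := by
    intro b hb
    have hp := le_propensity_of_mem hγ₀ hγ₁ hb
    refine le_trans (Real.sqrt_le_sqrt ?_) (inflation_sq_mul_le hγ₀ hγ₁ hK hn')
    unfold samplingVar
    gcongr
    refine adrVar_le (μ := μ b) n.succ_pos hq (fun s hs => (hp s hs).1) (fun s hs => (hp s hs).2)
      (scoreBound_nonneg hM.le) (fun s hs => ?_) hlarge (hdev (n + 1) hn b)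
    exact abs_sqrt_mul_score_sub_le (hx₀ b) (fun t ht => hrew t (by omega)) (hμ b) hq
      (.inr (hp s hs))
  have h1 := abs_samplingMean_sub_le hγ₀ hγ₁ (by omega) hi_mem (hdev (n + 1) hn i)
  have h2 := abs_samplingMean_sub_le hγ₀ hγ₁ (by omega) ha_mem (hdev (n + 1) hn a)
  have hv1 := samplingVar_pos hγ₀ hγ₁ hM hi_mem
  have hv2 := samplingVar_pos hγ₀ hγ₁ hM ha_mem
  have h3 := neg_sqrt_le_of_one_div_le_cdf_gaussian (by exact_mod_cast (by omega : 1 ≤ T)) hbeat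
  rw [le_div_iff₀ (Real.sqrt_pos.2 (by positivity)), Real.sqrt_mul (by norm_num)] at h3
  have h4 := sqrt_add_le_add_sqrt hv2.le hv1.le
  have h5 := hv i hi_mem
  have h6 := hv a ha_mem
  set D := √(240 * M ^ 2 * (144 * M ^ 2 + 1)) / γ ^ 2
  set u := √(samplingVar γ (inflation γ M K) T x₀ act rew (n + 1) i)
  set w := √(samplingVar γ (inflation γ M K) T x₀ act rew (n + 1) a)
  have hu : 0 ≤ u := Real.sqrt_nonneg _
  have hw : 0 ≤ w := Real.sqrt_nonneg _
  -- The comparison contributes `√2` and the estimation errors `1 / √3`; the decimals are chosen to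
  -- sum to `2`.
  have hs2 : √2 ≤ 1.42 := by rw [Real.sqrt_le_left (by norm_num)]; norm_num
  have hs3 : √(Real.log T / 3) ≤ 0.58 * √(Real.log T) := by
    rw [Real.sqrt_le_left (by positivity), mul_pow, Real.sq_sqrt hL]
    linarith
  have hsL := Real.sqrt_nonneg (Real.log T)
  have h7 : √2 * √(Real.log T) * √(samplingVar γ (inflation γ M K) T x₀ act rew (n + 1) a +
      samplingVar γ (inflation γ M K) T x₀ act rew (n + 1) i) ≤
      1.42 * √(Real.log T) * (w + u) := by gcongr
  have h8 : √(Real.log T / 3) * u ≤ 0.58 * √(Real.log T) * u := by gcongr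
  have h9 : √(Real.log T / 3) * w ≤ 0.58 * √(Real.log T) * w := by gcongr
  rw [abs_le] at h1 h2
  have h10 : μ i - μ a ≤ 2 * √(Real.log T) * (u + w) := by linarith
  calc _ ≤ 2 * √(Real.log T) * (D * K ^ 2 * (1 / √(n + 1 : ℕ)) +
        D * K ^ 2 * (1 / √(n + 1 : ℕ))) := h10.trans (by gcongr)
    _ = 4 * D * K ^ 2 * √(Real.log T / (n + 1 : ℕ)) := by
      rw [Real.sqrt_div hL]
      ring
    _ ≤ _ := by
      gcongr
      exact le_add_of_nonneg_right (by positivity)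

lemma sum_one_div_sqrt_le (n : ℕ) : ∑ k ∈ range n, 1 / √((k + 1 : ℕ) : ℝ) ≤ 2 * √(n : ℝ) := by
  induction n with
  | zero => simp
  | succ n ih =>
    rw [Finset.sum_range_succ]
    have h0 := Real.sqrt_nonneg (n : ℝ)
    have h1 : 0 < √((n + 1 : ℕ) : ℝ) := Real.sqrt_pos.2 (by positivity)
    have h2 := Real.sq_sqrt (Nat.cast_nonneg (α := ℝ) n)
    have h3 := Real.sq_sqrt (Nat.cast_nonneg (α := ℝ) (n + 1))
    push_cast at *
    -- Telescoping comparison with the increments of `2 √n`.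
    have h4 : 1 / √((n : ℝ) + 1) ≤ 2 * √((n : ℝ) + 1) - 2 * √(n : ℝ) := by
      rw [div_le_iff₀ h1]
      nlinarith [sq_nonneg (√((n : ℝ) + 1) - √(n : ℝ))]
    linarith

lemma regret_le_of_deviation_le (hγ₀ : 0 < γ) (hγ₁ : γ < 1) (hM : 0 < M) (hT : 600 ≤ T)
    (hx₀ : ∀ a, |x₀ a| ≤ M) (hrew : ∀ s < T, |rew s| ≤ M) (hμ : ∀ a, |μ a| ≤ M)
    (hdev : ∀ n < T, ∀ a, |deviation γ (inflation γ M K) T x₀ act rew n a (μ a)| ≤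
      2 * scoreBound γ M K * √(n * Real.log T)) {i : Fin K} (hi : ∀ a, μ a ≤ μ i)
    (hact : ∀ t < T, act t ∈ eligible γ (inflation γ M K) T x₀ act rew t) :
    ∑ t ∈ range T, (μ i - μ (act t)) ≤
      2 * M + 2 * gapConst γ M * K ^ 2 * √(T * Real.log T) := by
  have hL : 0 ≤ Real.log T := Real.log_nonneg (by exact_mod_cast (by omega : 1 ≤ T))
  have hC : 0 ≤ gapConst γ M := by
    unfold gapConst
    positivity
  obtain ⟨m, rfl⟩ : ∃ m, T = m + 1 := ⟨T - 1, by omega⟩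
  -- Round `0` precedes every elimination and is charged `2 M`; the gap bound covers rounds `t + 1`.
  rw [Finset.sum_range_succ']
  have h0 : μ i - μ (act 0) ≤ 2 * M := by
    have h1 := abs_le.1 (hμ i)
    have h2 := abs_le.1 (hμ (act 0))
    linarith
  have h1 : ∑ t ∈ range m, (μ i - μ (act (t + 1))) ≤
      ∑ t ∈ range m, gapConst γ M * K ^ 2 * √(Real.log (m + 1 : ℕ)) *
        (1 / √((t + 1 : ℕ) : ℝ)) := by
    refine Finset.sum_le_sum fun t ht => ?_
    have ht := Finset.mem_range.1 ht
    refine (gap_le_of_mem_eligible hγ₀ hγ₁ hM hT hx₀ hrew hμ hdev hi (by omega)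
      (hact (t + 1) (by omega))).trans (le_of_eq ?_)
    rw [Real.sqrt_div hL]
    ring
  rw [← Finset.mul_sum] at h1
  have h2 := (sum_one_div_sqrt_le m).trans
    (mul_le_mul_of_nonneg_left (Real.sqrt_le_sqrt (by simp : (m : ℝ) ≤ (m + 1 : ℕ))) zero_le_two)
  have h3 := h1.trans (mul_le_mul_of_nonneg_left h2 (by positivity))
  rw [Real.sqrt_mul (by positivity)]
  linarith

end GoodEvent

/-! ### Doubly robust scores and exponential moments -/

section General

variable {Ω : Type*} {m mΩ : MeasurableSpace Ω} {P : Measure Ω} [IsProbabilityMeasure P]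

/-- The doubly robust score with conditional propensity `P[I | m]` is conditionally unbiased. -/
lemma integral_mul_score_eq_zero (hm : m ≤ mΩ) {I R Z b : Ω → ℝ} {q B C μ : ℝ} (hq : 0 < q)
    (hI : Measurable I) (hI1 : ∀ ω, |I ω| ≤ 1) (hR : Measurable R) (hRC : ∀ᵐ ω ∂P, |R ω| ≤ C)
    (hb : Measurable[m] b) (hbC : ∀ᵐ ω ∂P, |b ω| ≤ C)
    (hp : ∀ᵐ ω ∂P, (P[I | m]) ω = 0 ∨ q ≤ (P[I | m]) ω ∧ (P[I | m]) ω ≤ 1)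
    (hZ : Measurable[m] Z) (hZB : ∀ᵐ ω ∂P, |Z ω| ≤ B)
    (hind : ∀ W : Ω → ℝ, Measurable[m] W →
      ∫ ω, W ω * I ω * R ω ∂P = (∫ ω, W ω * I ω ∂P) * μ) :
    ∫ ω, Z ω * (√((P[I | m]) ω) * (b ω + I ω * (R ω - b ω) / (P[I | m]) ω - μ)) ∂P = 0 := by
  have hpm : Measurable[m] (P[I | m]) := stronglyMeasurable_condExp.measurable
  set p := P[I | m] with hpdef
  have hIint : Integrable I P :=
    .of_bound hI.aestronglyMeasurable 1 (.of_forall hI1)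
  have hsp : ∀ᵐ ω ∂P, |√(p ω) / p ω| ≤ 1 / √q := by
    filter_upwards [hp] with ω h
    rcases h with h | ⟨h, -⟩
    · rw [h]
      simp
    · have := Real.sqrt_pos.2 hq
      rw [abs_of_nonneg (by have := hq.le.trans h; positivity), Real.sqrt_div_self']
      exact one_div_le_one_div_of_le this (Real.sqrt_le_sqrt h)
  -- Where `p = 0`, division by zero gives `W = 0`, so the identities below need no case of
  -- vanishing propensity.
  set W : Ω → ℝ := fun ω => Z ω * (√(p ω) / p ω) with hW
  have hWm : Measurable[m] W := hZ.mul (hpm.sqrt.div hpm)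
  have hWB : ∀ᵐ ω ∂P, |W ω| ≤ B * (1 / √q) := by
    filter_upwards [hZB, hsp] with ω h1 h2
    rw [hW, abs_mul]
    exact mul_le_mul h1 h2 (abs_nonneg _) ((abs_nonneg _).trans h1)
  -- Tower property: under the integral, `p` may be exchanged for `I` against a bounded
  -- `m`-measurable factor. After the exchange the baseline `b` cancels.
  have pull : ∀ V : Ω → ℝ, Measurable[m] V → (∀ᵐ ω ∂P, |V ω| ≤ B * (1 / √q) * (C + |μ|)) →
      Integrable (fun ω => V ω * I ω) P ∧ Integrable (fun ω => V ω * p ω) P ∧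
      ∫ ω, V ω * p ω ∂P = ∫ ω, V ω * I ω ∂P := by
    intro V hV hVB
    have hV' : AEStronglyMeasurable V P := (hV.mono hm le_rfl).aestronglyMeasurable
    refine ⟨hIint.bdd_mul hV' hVB, integrable_condExp.bdd_mul hV' hVB, ?_⟩
    have h := condExp_stronglyMeasurable_mul_of_bound hm hV.stronglyMeasurable hIint _ hVB
    rw [← integral_condExp hm (f := fun ω => V ω * I ω)]
    exact (integral_congr_ae h).symm
  have hBC : ∀ (f : Ω → ℝ), (∀ᵐ ω ∂P, |f ω| ≤ C + |μ|) →
      ∀ᵐ ω ∂P, |W ω * f ω| ≤ B * (1 / √q) * (C + |μ|) := by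
    intro f hf
    filter_upwards [hWB, hf] with ω h1 h2
    rw [abs_mul]
    exact mul_le_mul h1 h2 (abs_nonneg _) ((abs_nonneg _).trans h1)
  obtain ⟨i1, -, -⟩ := pull (fun ω => W ω * b ω) (hWm.mul hb) (hBC b (by
    filter_upwards [hbC] with ω h
    linarith [abs_nonneg μ]))
  obtain ⟨i2, -, -⟩ := pull (fun ω => W ω * μ) (hWm.mul_const μ) (hBC (fun _ => μ) (by
    filter_upwards [hbC] with ω h
    linarith [abs_nonneg (b ω)]))
  obtain ⟨-, i3, e3⟩ := pull (fun ω => W ω * (b ω - μ)) (hWm.mul (hb.sub_const μ))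
    (hBC (fun ω => b ω - μ) (by
      filter_upwards [hbC] with ω h
      exact (abs_sub _ _).trans (by linarith)))
  have i4 : Integrable (fun ω => W ω * I ω * R ω) P := by
    refine .of_bound (((hWm.mono hm le_rfl).mul hI).mul hR).aestronglyMeasurable
      (B * (1 / √q) * 1 * C) ?_
    filter_upwards [hWB, hRC] with ω h1 h2
    rw [Real.norm_eq_abs, abs_mul, abs_mul]
    have := (abs_nonneg _).trans h1
    have := hI1 ω
    gcongr
  have hpt : ∀ ω, Z ω * (√(p ω) * (b ω + I ω * (R ω - b ω) / p ω - μ)) =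
      W ω * (b ω - μ) * p ω + (W ω * I ω * R ω - W ω * b ω * I ω) := by
    intro ω
    have : √(p ω) / p ω * p ω = √(p ω) := by
      by_cases h : p ω = 0
      · simp [h]
      · field_simp
    calc _ = Z ω * (b ω - μ) * √(p ω) + Z ω * (√(p ω) / p ω) * (I ω * (R ω - b ω)) := by ring
      _ = Z ω * (b ω - μ) * (√(p ω) / p ω * p ω) +
          Z ω * (√(p ω) / p ω) * (I ω * (R ω - b ω)) := by rw [this]
      _ = _ := by
        simp only [hW]
        ring
  simp_rw [hpt]
  rw [integral_add (f := fun ω => W ω * (b ω - μ) * p ω)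
    (g := fun ω => W ω * I ω * R ω - W ω * b ω * I ω) i3 (i4.sub i1), integral_sub i4 i1, e3, hind W hWm, ← integral_mul_const]
  have e5 : ∫ ω, W ω * (b ω - μ) * I ω ∂P =
      ∫ ω, W ω * b ω * I ω ∂P - ∫ ω, W ω * I ω * μ ∂P := by
    rw [← integral_sub i1 (by simpa only [mul_right_comm] using i2)]
    refine integral_congr_ae (.of_forall fun ω => ?_)
    simp only
    ring
  rw [e5]
  ring

/-- One step of Azuma–Hoeffding. By convexity `exp (t X)` lies below its chord on `[-c, c]`; the
linear part of the chord integrates to zero, and `cosh x ≤ exp (x ^ 2 / 2)`. The martingale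
difference property is phrased as orthogonality to bounded `m`-measurable functions. -/
lemma integral_exp_add_le (hm : m ≤ mΩ) {S X : Ω → ℝ} {B c t : ℝ} (hc : 0 < c)
    (hS : Measurable[m] S) (hSB : ∀ᵐ ω ∂P, |S ω| ≤ B) (hX : Measurable X)
    (hXc : ∀ᵐ ω ∂P, |X ω| ≤ c)
    (h0 : ∀ (Z : Ω → ℝ) (B : ℝ), Measurable[m] Z → (∀ᵐ ω ∂P, |Z ω| ≤ B) →
      ∫ ω, Z ω * X ω ∂P = 0) :
    ∫ ω, Real.exp (t * (S ω + X ω)) ∂P ≤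
      Real.exp (t ^ 2 * c ^ 2 / 2) * ∫ ω, Real.exp (t * S ω) ∂P := by
  have hS' : Measurable S := hS.mono hm le_rfl
  have hZm : Measurable[m] fun ω => Real.exp (t * S ω) := (hS.const_mul t).exp
  have hZ' : Measurable fun ω => Real.exp (t * S ω) := (hS'.const_mul t).exp
  have hZB : ∀ᵐ ω ∂P, |Real.exp (t * S ω)| ≤ Real.exp (|t| * B) := by
    filter_upwards [hSB] with ω h
    rw [Real.abs_exp, Real.exp_le_exp]
    refine (le_abs_self _).trans ?_
    rw [abs_mul]
    gcongr
  have iZ : Integrable (fun ω => Real.exp (t * S ω)) P :=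
    .of_bound hZ'.aestronglyMeasurable _ hZB
  have iZX : Integrable (fun ω => Real.exp (t * S ω) * X ω) P := by
    refine .of_bound (hZ'.mul hX).aestronglyMeasurable (Real.exp (|t| * B) * c) ?_
    filter_upwards [hZB, hXc] with ω h1 h2
    rw [Real.norm_eq_abs, abs_mul]
    gcongr
  have iE : Integrable (fun ω => Real.exp (t * (S ω + X ω))) P := by
    refine .of_bound ((hS'.add hX).const_mul t).exp.aestronglyMeasurable
      (Real.exp (|t| * (B + c))) ?_
    filter_upwards [hSB, hXc] with ω h1 h2
    rw [Real.norm_eq_abs, Real.abs_exp, Real.exp_le_exp]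
    refine (le_abs_self _).trans ?_
    rw [abs_mul]
    gcongr
    exact (abs_add_le _ _).trans (add_le_add h1 h2)
  calc _ ≤ ∫ ω, (Real.cosh (c * t) * Real.exp (t * S ω) +
        Real.sinh (c * t) / c * (Real.exp (t * S ω) * X ω)) ∂P := by
        refine integral_mono_ae iE ((iZ.const_mul _).add (iZX.const_mul _)) ?_
        filter_upwards [hXc] with ω h
        have h1 : |X ω / c| ≤ 1 := by
          rw [abs_div, abs_of_pos hc, div_le_one hc]
          exact h
        have h2 := Real.exp_mul_le_cosh_add_mul_sinh h1 (c * t)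
        rw [show X ω / c * (c * t) = t * X ω by field_simp] at h2
        calc _ = Real.exp (t * S ω) * Real.exp (t * X ω) := by rw [← Real.exp_add]; ring_nf
          _ ≤ Real.exp (t * S ω) * (Real.cosh (c * t) + X ω / c * Real.sinh (c * t)) := by gcongr
          _ = _ := by ring
    _ = Real.cosh (c * t) * ∫ ω, Real.exp (t * S ω) ∂P := by
        rw [integral_add (iZ.const_mul _) (iZX.const_mul _), integral_const_mul,
          integral_const_mul, h0 _ _ hZm hZB]
        ring
    _ ≤ _ := by
        have : 0 ≤ ∫ ω, Real.exp (t * S ω) ∂P := integral_nonneg fun _ => (Real.exp_pos _).le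
        gcongr
        refine (Real.cosh_le_exp_half_sq _).trans (le_of_eq ?_)
        ring_nf

end General

/-! ### Elementary bounds on means and regrets -/

section Means

variable {K T : ℕ} {ν : Measure (Fin K → ℝ)} {M : ℝ}

lemma abs_armMean_le [IsProbabilityMeasure ν] (hν : ∀ᵐ x ∂ν, ∀ a, |x a| ≤ M) (a : Fin K) :
    |armMean ν a| ≤ M := by
  have := norm_integral_le_of_norm_le_const (μ := ν) (f := fun x => x a) (C := M)
    (by filter_upwards [hν] with x hx using hx a)
  simpa [armMean] using this

lemma exists_best_arm (ν : Measure (Fin K → ℝ)) (hK : 1 ≤ K) :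
    ∃ i, armMean ν i = ⨆ a, armMean ν a := by
  have : Nonempty (Fin K) := ⟨⟨0, hK⟩⟩
  exact exists_eq_ciSup_of_finite

lemma abs_regret_le [IsProbabilityMeasure ν] (hK : 1 ≤ K) (hν : ∀ᵐ x ∂ν, ∀ a, |x a| ≤ M)
    {Ω : Type*}
    {act : ℕ → Ω → Fin K} (ω : Ω) : |regret ν T act ω| ≤ 2 * M * T := by
  obtain ⟨i, hi⟩ := exists_best_arm ν hK
  rw [regret, ← hi]
  refine (Finset.abs_sum_le_sum_abs _ _).trans ((Finset.sum_le_card_nsmul _ _ (2 * M)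
    fun t _ => ?_).trans (le_of_eq ?_))
  · have h1 := abs_le.1 (abs_armMean_le hν i)
    have h2 := abs_le.1 (abs_armMean_le hν (act t ω))
    exact abs_le.2 ⟨by linarith, by linarith⟩
  · rw [Finset.card_range, nsmul_eq_mul]
    ring

end Means

/-! ### The run of the algorithm -/

section Run

variable {Ω : Type*} {K : ℕ} {init : Ω → Fin K → ℝ} {r : ℕ → Ω → Fin K → ℝ} {act : ℕ → Ω → Fin K}

/-- The σ-algebra of the observed past before round `n`. -/
abbrev past (init : Ω → Fin K → ℝ) (r : ℕ → Ω → Fin K → ℝ) (act : ℕ → Ω → Fin K) (n : ℕ) :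
    MeasurableSpace Ω :=
  MeasurableSpace.comap (history init r act n) inferInstance

lemma measurable_init_past (n : ℕ) : Measurable[past init r act n] init :=
  measurable_fst.comp (comap_measurable (history init r act n))

lemma measurable_obs_past {n s : ℕ} (hs : s < n) :
    Measurable[past init r act n] fun ω => (act s ω, r s ω (act s ω)) :=
  ((measurable_pi_apply (⟨s, hs⟩ : Fin n)).comp measurable_snd).comp
    (comap_measurable (history init r act n))

lemma measurable_act_past {n s : ℕ} (hs : s < n) : Measurable[past init r act n] (act s) :=
  measurable_fst.comp (measurable_obs_past hs)

lemma measurable_rew_past {n s : ℕ} (hs : s < n) :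
    Measurable[past init r act n] fun ω => r s ω (act s ω) :=
  measurable_snd.comp (measurable_obs_past hs)

lemma past_mono : Monotone (past init r act) := by
  intro n k hnk
  have h : Measurable[past init r act k] (history init r act n) :=
    (measurable_init_past k).prodMk
      (@measurable_pi_lambda _ _ _ (past init r act k) _ _
        fun s : Fin n => measurable_obs_past (s.2.trans_le hnk))
  exact h.comap_le

lemma measurable_sampleMean_past (n : ℕ) (a : Fin K) : Measurable[past init r act n]
    fun ω => sampleMean (init ω) (fun s => act s ω) (fun s => r s ω (act s ω)) n a := by
  have hset : ∀ s < n, MeasurableSet[past init r act n] {ω | act s ω = a} := fun s hs =>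
    measurable_act_past hs (measurableSet_singleton a)
  unfold sampleMean
  simp only [Finset.card_filter, Nat.cast_sum, Nat.cast_ite, Nat.cast_one, Nat.cast_zero]
  refine Measurable.div (Measurable.add ?_ ?_) (Measurable.add measurable_const ?_)
  · exact (measurable_pi_apply a).comp (measurable_init_past n)
  · refine Finset.measurable_fun_sum _ fun s hs => ?_
    have hs := Finset.mem_range.1 hs
    exact Measurable.ite (hset s hs) (measurable_rew_past hs) measurable_const
  · refine Finset.measurable_fun_sum _ fun s hs => ?_
    have hs := Finset.mem_range.1 hs
    exact Measurable.ite (hset s hs) measurable_const measurable_const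

variable [mΩ : MeasurableSpace Ω] {P : Measure Ω} {ν : Measure (Fin K → ℝ)}

/-- The conditional probability, given the observed past, that arm `a` is pulled in round `n`. -/
def condProp (P : Measure Ω) (init : Ω → Fin K → ℝ) (r : ℕ → Ω → Fin K → ℝ)
    (act : ℕ → Ω → Fin K) (n : ℕ) (a : Fin K) : Ω → ℝ :=
  P[Set.indicator {ω | act n ω = a} (fun _ => (1 : ℝ)) | past init r act n]

/-- The weighted deviation of the efficient score of arm `a` in round `n` from the mean reward. -/
def increment (P : Measure Ω) (ν : Measure (Fin K → ℝ)) (init : Ω → Fin K → ℝ)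
    (r : ℕ → Ω → Fin K → ℝ) (act : ℕ → Ω → Fin K) (n : ℕ) (a : Fin K) (ω : Ω) : ℝ :=
  √(condProp P init r act n a ω) *
    (score (init ω) (fun s => act s ω) (fun s => r s ω (act s ω)) n a
      (condProp P init r act n a ω) - armMean ν a)

lemma measurable_condProp_past (n : ℕ) (a : Fin K) :
    Measurable[past init r act n] (condProp P init r act n a) :=
  stronglyMeasurable_condExp.measurable

/-- The observed reward depends on the pulled arm; on the event `act n = a` it can be replaced by `r
n ω a`, which is independent of the past and of the pulled arm. -/
lemma increment_eq (n : ℕ) (a : Fin K) (ω : Ω) : increment P ν init r act n a ω =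
    √(condProp P init r act n a ω) *
      (sampleMean (init ω) (fun s => act s ω) (fun s => r s ω (act s ω)) n a +
        Set.indicator {ω | act n ω = a} (fun _ => (1 : ℝ)) ω *
          (r n ω a - sampleMean (init ω) (fun s => act s ω) (fun s => r s ω (act s ω)) n a) /
          condProp P init r act n a ω - armMean ν a) := by
  unfold increment score
  by_cases h : act n ω = a
  · simp [h]
  · simp [h]

lemma measurable_increment_past (n : ℕ) (a : Fin K) :
    Measurable[past init r act (n + 1)] (increment P ν init r act n a) := by
  have h1 := (measurable_sampleMean_past (init := init) (r := r) (act := act) n a).mono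
    (past_mono n.le_succ) le_rfl
  have h2 := (measurable_condProp_past (P := P) (init := init) (r := r) (act := act) n a).mono
    (past_mono n.le_succ) le_rfl
  have hset : MeasurableSet[past init r act (n + 1)] {ω | act n ω = a} :=
    measurable_act_past n.lt_succ_self (measurableSet_singleton a)
  unfold increment score
  exact h2.sqrt.mul ((h1.add (Measurable.ite hset
    (((measurable_rew_past n.lt_succ_self).sub h1).div h2) measurable_const)).sub_const _)

lemma measurable_sum_increment_past (n : ℕ) (a : Fin K) : Measurable[past init r act n]
    fun ω => ∑ s ∈ range n, increment P ν init r act s a ω :=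
  Finset.measurable_fun_sum _ fun s hs =>
    (measurable_increment_past s a).mono (past_mono (Finset.mem_range.1 hs)) le_rfl


end Run

/-! ### Martingale concentration along a run -/

section Run

variable {Ω : Type*} [mΩ : MeasurableSpace Ω] {P : Measure Ω} {K T : ℕ}
  {ν : Measure (Fin K → ℝ)} {γ κ M : ℝ} {init : Ω → Fin K → ℝ}
  {r : ℕ → Ω → Fin K → ℝ} {act : ℕ → Ω → Fin K}

lemma IsRun.past_le (h : IsRun P ν γ κ T init r act) {n : ℕ} (hn : n ≤ T) :
    past init r act n ≤ mΩ := by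
  have hobs : ∀ s < T, Measurable fun ω => r s ω (act s ω) := by
    intro s hs
    -- Evaluation at a random arm becomes a finite sum, which is visibly measurable.
    have he : (fun ω => r s ω (act s ω)) = fun ω => ∑ a, if act s ω = a then r s ω a else 0 := by
      funext ω
      simp
    rw [he]
    exact Finset.measurable_fun_sum _ fun a _ => Measurable.ite
      (h.measurable_act s hs (measurableSet_singleton a))
      ((measurable_pi_apply a).comp (h.measurable_reward s hs)) measurable_const
  have hh : Measurable (history init r act n) :=
    h.measurable_init.prodMk (measurable_pi_lambda _ fun s : Fin n =>
      (h.measurable_act s (s.2.trans_le hn)).prodMk (hobs s (s.2.trans_le hn)))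
  exact hh.comap_le

lemma IsRun.ae_abs_le [IsProbabilityMeasure ν] (h : IsRun P ν γ κ T init r act)
    (hν : ∀ᵐ x ∂ν, ∀ a, |x a| ≤ M) :
    ∀ᵐ ω ∂P, (∀ a, |init ω a| ≤ M) ∧ ∀ s < T, ∀ a, |r s ω a| ≤ M := by
  refine Filter.Eventually.and ?_ ?_
  · rw [ae_all_iff]
    intro a
    have hmeas : ∀ b : Fin K, Measurable fun x : Fin K → ℝ => x b := measurable_pi_apply
    have : ∀ b : Fin K, IsProbabilityMeasure (ν.map fun x => x b) := fun b =>
      Measure.isProbabilityMeasure_map (hmeas b).aemeasurable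
    have h1 : P.map (fun ω => init ω a) = ν.map fun x => x a := by
      rw [← (measurePreserving_eval (fun b : Fin K => ν.map fun x => x b) a).map_eq,
        ← h.law_init, Measure.map_map (measurable_pi_apply a) h.measurable_init]
      rfl
    have hset : MeasurableSet {y : ℝ | |y| ≤ M} := measurableSet_le measurable_id.abs
      measurable_const
    refine ae_of_ae_map (f := fun ω => init ω a) (p := fun y => |y| ≤ M)
      ((hmeas a).comp h.measurable_init).aemeasurable ?_
    rw [h1, ae_map_iff (hmeas a).aemeasurable hset]
    filter_upwards [hν] with x hx using hx a
  · rw [ae_all_iff]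
    intro s
    rw [ae_all_iff]
    intro hs
    refine ae_of_ae_map (f := r s) (p := fun x => ∀ a, |x a| ≤ M)
      (h.measurable_reward s hs).aemeasurable ?_
    rw [h.law_reward s hs]
    exact hν

/-- Lets the probabilistic arguments use the conditional expectation, whose measurability is
automatic, so that measurability of `propensity` need not be proved. -/
lemma IsRun.ae_condProp_eq (h : IsRun P ν γ κ T init r act) :
    ∀ᵐ ω ∂P, ∀ s < T, ∀ a, condProp P init r act s a ω =
      propensity γ κ T (init ω) (fun s => act s ω) (fun s => r s ω (act s ω)) s a := by
  rw [ae_all_iff]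
  intro s
  rw [ae_all_iff]
  intro hs
  rw [ae_all_iff]
  intro a
  exact h.law_act s hs a

lemma IsRun.measurable_indicator_act (h : IsRun P ν γ κ T init r act) {s : ℕ} (hs : s < T)
    (a : Fin K) : Measurable (Set.indicator {ω | act s ω = a} fun _ => (1 : ℝ)) :=
  measurable_const.indicator (h.measurable_act s hs (measurableSet_singleton a))

/-- On the past-measurable set where its conditional probability vanishes, an arm is pulled with
probability zero, and ineligible arms have propensity zero. -/
lemma IsRun.ae_act_mem [IsProbabilityMeasure P] (h : IsRun P ν γ κ T init r act) :
    ∀ᵐ ω ∂P, ∀ t < T, act t ω ∈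
      eligible γ κ T (init ω) (fun s => act s ω) (fun s => r s ω (act s ω)) t := by
  have hzero : ∀ᵐ ω ∂P, ∀ t < T, ∀ a, ¬ (act t ω = a ∧ condProp P init r act t a ω = 0) := by
    rw [ae_all_iff]
    intro t
    rw [ae_all_iff]
    intro ht
    rw [ae_all_iff]
    intro a
    have hN : MeasurableSet[past init r act t] {ω | condProp P init r act t a ω = 0} :=
      measurable_condProp_past t a (measurableSet_singleton 0)
    have hE : MeasurableSet {ω | act t ω = a} :=
      h.measurable_act t ht (measurableSet_singleton a)
    have hint : Integrable (Set.indicator {ω | act t ω = a} fun _ => (1 : ℝ)) P :=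
      (integrable_const 1).indicator hE
    have h1 : ∫ ω in {ω | condProp P init r act t a ω = 0}, condProp P init r act t a ω ∂P =
        ∫ ω in {ω | condProp P init r act t a ω = 0},
          Set.indicator {ω | act t ω = a} (fun _ => (1 : ℝ)) ω ∂P :=
      setIntegral_condExp (h.past_le ht.le) hint hN
    rw [setIntegral_congr_fun (g := fun _ => (0 : ℝ)) (h.past_le ht.le _ hN)
      (fun ω hω => hω), integral_zero, integral_indicator hE,
      Measure.restrict_restrict hE] at h1
    simp only [integral_const, smul_eq_mul, mul_one, MeasurableSet.univ, measureReal_restrict_apply,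
      Set.univ_inter] at h1
    rw [ae_iff]
    simp only [not_not]
    exact (measureReal_eq_zero_iff).1 h1.symm
  filter_upwards [hzero, h.ae_condProp_eq] with ω h1 h2 t ht
  by_contra hmem
  exact h1 t ht _ ⟨rfl, (h2 t ht _).trans (propensity_of_notMem κ T _ _ _ hmem)⟩

lemma IsRun.integral_mul_indicator_mul_reward [IsProbabilityMeasure P]
    (h : IsRun P ν γ κ T init r act) {s : ℕ} (hs : s < T) (a : Fin K) {W : Ω → ℝ}
    (hW : Measurable[past init r act s] W) :
    ∫ ω, W ω * Set.indicator {ω | act s ω = a} (fun _ => (1 : ℝ)) ω * r s ω a ∂P =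
      (∫ ω, W ω * Set.indicator {ω | act s ω = a} (fun _ => (1 : ℝ)) ω ∂P) * armMean ν a := by
  have hra : Measurable fun ω => r s ω a :=
    (measurable_pi_apply a).comp (h.measurable_reward s hs)
  have hmean : ∫ ω, r s ω a ∂P = armMean ν a := by
    rw [armMean, ← h.law_reward s hs, integral_map (h.measurable_reward s hs).aemeasurable
      (measurable_pi_apply a).aestronglyMeasurable]
  have hpair := comap_measurable (m := inferInstance)
    fun ω => (history init r act s ω, act s ω)
  have hle : past init r act s ≤
      MeasurableSpace.comap (fun ω => (history init r act s ω, act s ω)) inferInstance :=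
    (measurable_fst.comp hpair).comap_le
  have hset : MeasurableSet[MeasurableSpace.comap
      (fun ω => (history init r act s ω, act s ω)) inferInstance] {ω | act s ω = a} :=
    (measurable_snd.comp hpair) (measurableSet_singleton a)
  have hWI := (hW.mono hle le_rfl).mul (Measurable.indicator (measurable_const (a := (1 : ℝ))) hset)
  have hind : IndepFun
      (fun ω => W ω * Set.indicator {ω | act s ω = a} (fun _ => (1 : ℝ)) ω)
      (fun ω => r s ω a) P :=
    indep_of_indep_of_le_left
      (((h.indep_reward s hs).comp measurable_id (measurable_pi_apply a))) hWI.comap_le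
  rw [hind.integral_fun_mul_eq_mul_integral, hmean]
  · exact ((hW.mono (h.past_le hs.le) le_rfl).mul
      (h.measurable_indicator_act hs a)).aestronglyMeasurable
  · exact hra.aestronglyMeasurable

lemma IsRun.ae_condProp_eq_zero_or (h : IsRun P ν γ κ T init r act) (hγ₀ : 0 < γ)
    (hγ₁ : γ < 1) : ∀ᵐ ω ∂P, ∀ s < T, ∀ a, condProp P init r act s a ω = 0 ∨
      γ / K ≤ condProp P init r act s a ω ∧ condProp P init r act s a ω ≤ 1 := by
  filter_upwards [h.ae_condProp_eq] with ω hω s hs a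
  rw [hω s hs a]
  exact propensity_eq_zero_or κ T _ _ _ hγ₀ hγ₁ s a

lemma IsRun.integral_mul_increment [IsProbabilityMeasure P] [IsProbabilityMeasure ν]
    (h : IsRun P ν γ κ T init r act) (hγ₀ : 0 < γ) (hγ₁ : γ < 1)
    (hν : ∀ᵐ x ∂ν, ∀ a, |x a| ≤ M) {s : ℕ} (hs : s < T) (a : Fin K) {Z : Ω → ℝ} {B : ℝ}
    (hZ : Measurable[past init r act s] Z) (hZB : ∀ᵐ ω ∂P, |Z ω| ≤ B) :
    ∫ ω, Z ω * increment P ν init r act s a ω ∂P = 0 := by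
  have hK : (0 : ℝ) < K := by exact_mod_cast a.pos
  simp_rw [increment_eq]
  refine integral_mul_score_eq_zero (q := γ / K) (C := M) (h.past_le hs.le) (by positivity)
    (h.measurable_indicator_act hs a) (fun ω => ?_)
    ((measurable_pi_apply a).comp (h.measurable_reward s hs)) ?_
    (measurable_sampleMean_past s a) ?_ ?_ hZ hZB
    fun W hW => h.integral_mul_indicator_mul_reward hs a hW
  · by_cases hω : act s ω = a <;> simp [hω]
  · filter_upwards [h.ae_abs_le hν] with ω hω using hω.2 s hs a
  · filter_upwards [h.ae_abs_le hν] with ω hω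
    exact abs_sampleMean_le (hω.1 a) fun t ht => hω.2 t (ht.trans hs) _
  · filter_upwards [h.ae_condProp_eq_zero_or hγ₀ hγ₁] with ω hω using hω s hs a

lemma IsRun.ae_abs_increment_le [IsProbabilityMeasure ν]
    (h : IsRun P ν γ κ T init r act) (hγ₀ : 0 < γ) (hγ₁ : γ < 1)
    (hν : ∀ᵐ x ∂ν, ∀ a, |x a| ≤ M) :
    ∀ᵐ ω ∂P, ∀ s < T, ∀ a, |increment P ν init r act s a ω| ≤ scoreBound γ M K := by
  filter_upwards [h.ae_abs_le hν, h.ae_condProp_eq_zero_or hγ₀ hγ₁] with ω h1 h2 s hs a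
  have hK : (0 : ℝ) < K := by exact_mod_cast a.pos
  exact abs_sqrt_mul_score_sub_le (h1.1 a) (fun t ht => h1.2 t (by omega) _)
    (abs_armMean_le hν a) (by positivity) (h2 s hs a)

lemma IsRun.ae_abs_sum_increment_le [IsProbabilityMeasure ν]
    (h : IsRun P ν γ κ T init r act) (hγ₀ : 0 < γ) (hγ₁ : γ < 1)
    (hν : ∀ᵐ x ∂ν, ∀ a, |x a| ≤ M) {n : ℕ} (hn : n ≤ T) (a : Fin K) :
    ∀ᵐ ω ∂P, |∑ s ∈ range n, increment P ν init r act s a ω| ≤ n * scoreBound γ M K := by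
  filter_upwards [h.ae_abs_increment_le hγ₀ hγ₁ hν] with ω hω
  refine (Finset.abs_sum_le_sum_abs _ _).trans ((Finset.sum_le_card_nsmul _ _ _ fun s hs =>
    hω s ((Finset.mem_range.1 hs).trans_le hn) a).trans (le_of_eq ?_))
  simp

lemma IsRun.integral_exp_sum_increment_le [IsProbabilityMeasure P] [IsProbabilityMeasure ν]
    (h : IsRun P ν γ κ T init r act) (hγ₀ : 0 < γ) (hγ₁ : γ < 1) (hM : 0 < M)
    (hν : ∀ᵐ x ∂ν, ∀ a, |x a| ≤ M) (a : Fin K) (t : ℝ) (n : ℕ) (hn : n ≤ T) :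
    ∫ ω, Real.exp (t * ∑ s ∈ range n, increment P ν init r act s a ω) ∂P ≤
      Real.exp (n * (t ^ 2 * scoreBound γ M K ^ 2 / 2)) := by
  induction n with
  | zero => simp
  | succ n ih =>
    have hc : 0 < scoreBound γ M K := by
      unfold scoreBound
      positivity
    simp_rw [Finset.sum_range_succ]
    refine (integral_exp_add_le (h.past_le (by omega : n ≤ T)) hc
      (measurable_sum_increment_past n a)
      (h.ae_abs_sum_increment_le hγ₀ hγ₁ hν (by omega) a)
      ((measurable_increment_past n a).mono (h.past_le hn) le_rfl) ?_ ?_).trans ?_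
    · filter_upwards [h.ae_abs_increment_le hγ₀ hγ₁ hν] with ω hω using hω n (by omega) a
    · exact fun Z B hZ hZB => h.integral_mul_increment hγ₀ hγ₁ hν (by omega) a hZ hZB
    · refine (mul_le_mul_of_nonneg_left (ih (by omega)) (Real.exp_pos _).le).trans (le_of_eq ?_)
      rw [← Real.exp_add]
      push_cast
      ring_nf

lemma measureReal_lt_abs_le [IsProbabilityMeasure P] {S : Ω → ℝ} {v ε : ℝ} (hv : 0 < v)
    (hε : 0 ≤ ε) (hint : ∀ t, Integrable (fun ω => Real.exp (t * S ω)) P)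
    (hS : ∀ t, ∫ ω, Real.exp (t * S ω) ∂P ≤ Real.exp (t ^ 2 * v / 2)) :
    P.real {ω | ε < |S ω|} ≤ 2 * Real.exp (-(ε ^ 2 / (2 * v))) := by
  -- `t = ε / v` minimises the Chernoff exponent `-t ε + t ^ 2 v / 2`.
  have h1 := measure_ge_le_exp_mul_mgf (μ := P) (X := S) ε (by positivity : 0 ≤ ε / v) (hint _)
  have h2 := measure_le_le_exp_mul_mgf (μ := P) (X := S) (t := -(ε / v)) (-ε)
    (neg_nonpos.2 (by positivity)) (hint _)
  have e : ∀ t, -(t * ε) + t ^ 2 * v / 2 = -(ε ^ 2 / (2 * v)) →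
      Real.exp (-t * ε) * mgf S P t ≤ Real.exp (-(ε ^ 2 / (2 * v))) := by
    intro t ht
    refine (mul_le_mul_of_nonneg_left (hS t) (Real.exp_pos _).le).trans (le_of_eq ?_)
    rw [← Real.exp_add, ← ht]
    ring_nf
  have h1' := h1.trans (e _ (by field_simp; ring))
  have h2' : P.real {ω | S ω ≤ -ε} ≤ Real.exp (-(ε ^ 2 / (2 * v))) := by
    refine h2.trans ((mul_le_mul_of_nonneg_left (hS _) (Real.exp_pos _).le).trans (le_of_eq ?_))
    rw [← Real.exp_add]
    congr 1
    field_simp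
    ring
  calc _ ≤ P.real ({ω | ε ≤ S ω} ∪ {ω | S ω ≤ -ε}) := by
        refine measureReal_mono fun ω hω => ?_
        rcases lt_abs.1 (show ε < |S ω| from hω) with h | h
        · exact .inl h.le
        · exact .inr (show S ω ≤ -ε by linarith)
    _ ≤ _ := measureReal_union_le _ _
    _ ≤ _ := by linarith

lemma IsRun.measureReal_sum_increment_le [IsProbabilityMeasure P] [IsProbabilityMeasure ν]
    (h : IsRun P ν γ κ T init r act) (hγ₀ : 0 < γ) (hγ₁ : γ < 1) (hM : 0 < M)
    (hν : ∀ᵐ x ∂ν, ∀ a, |x a| ≤ M) (hT : 1 ≤ T) (a : Fin K) {n : ℕ} (hn : n ≤ T) :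
    P.real {ω | 2 * scoreBound γ M K * √(n * Real.log T) <
      |∑ s ∈ range n, increment P ν init r act s a ω|} ≤ 2 / (T : ℝ) ^ 2 := by
  -- For `n = 0` the variance proxy `n c ^ 2` vanishes, but the event is empty.
  rcases n.eq_zero_or_pos with rfl | hn0
  · simp
    positivity
  have hc : 0 < scoreBound γ M K := by
    unfold scoreBound
    positivity
  have hL : 0 ≤ Real.log T := Real.log_nonneg (by exact_mod_cast hT)
  have hn0' : (0 : ℝ) < n := by exact_mod_cast hn0
  have hT0 : (0 : ℝ) < T := by exact_mod_cast hT
  refine (measureReal_lt_abs_le (v := n * scoreBound γ M K ^ 2) (by positivity) (by positivity)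
    (fun t => ?_) fun t => ?_).trans (le_of_eq ?_)
  · refine .of_bound ((((measurable_sum_increment_past n a).mono (h.past_le hn)
      le_rfl).const_mul t).exp).aestronglyMeasurable
      (Real.exp (|t| * (n * scoreBound γ M K))) ?_
    filter_upwards [h.ae_abs_sum_increment_le hγ₀ hγ₁ hν hn a] with ω hω
    rw [Real.norm_eq_abs, Real.abs_exp, Real.exp_le_exp]
    refine (le_abs_self _).trans ?_
    rw [abs_mul]
    gcongr
  · refine (h.integral_exp_sum_increment_le hγ₀ hγ₁ hM hν a t n hn).trans (le_of_eq ?_)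
    ring_nf
  · rw [mul_pow, Real.sq_sqrt (by positivity),
      show -((2 * scoreBound γ M K) ^ 2 * (n * Real.log T) / (2 * (n * scoreBound γ M K ^ 2))) =
        Real.log (T : ℝ) * (-2 : ℝ) by field_simp, ← Real.rpow_def_of_pos hT0,
      Real.rpow_neg hT0.le, Real.rpow_two]
    rfl

/-- The event that some weighted sum of efficient scores deviates too much from its mean. -/
def badEvent (P : Measure Ω) (ν : Measure (Fin K → ℝ)) (γ M : ℝ) (T : ℕ) (init : Ω → Fin K → ℝ)
    (r : ℕ → Ω → Fin K → ℝ) (act : ℕ → Ω → Fin K) : Set Ω :=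
  ⋃ i ∈ range T ×ˢ (Finset.univ : Finset (Fin K)),
    {ω | 2 * scoreBound γ M K * √(i.1 * Real.log T) <
      |∑ s ∈ range i.1, increment P ν init r act s i.2 ω|}

lemma IsRun.measurableSet_badEvent (h : IsRun P ν γ κ T init r act) :
    MeasurableSet (badEvent P ν γ M T init r act) :=
  Finset.measurableSet_biUnion _ fun i hi => measurableSet_lt measurable_const
    ((measurable_sum_increment_past i.1 i.2).mono
      (h.past_le (Finset.mem_range.1 (Finset.mem_product.1 hi).1).le) le_rfl).abs

lemma IsRun.measureReal_badEvent_le [IsProbabilityMeasure P] [IsProbabilityMeasure ν]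
    (h : IsRun P ν γ κ T init r act) (hγ₀ : 0 < γ) (hγ₁ : γ < 1) (hM : 0 < M)
    (hν : ∀ᵐ x ∂ν, ∀ a, |x a| ≤ M) (hT : 1 ≤ T) :
    P.real (badEvent P ν γ M T init r act) ≤ 2 * K / T := by
  have hT0 : (0 : ℝ) < T := by exact_mod_cast hT
  refine (measureReal_biUnion_finset_le _ _).trans
    ((Finset.sum_le_card_nsmul _ _ (2 / (T : ℝ) ^ 2) fun i hi =>
      h.measureReal_sum_increment_le hγ₀ hγ₁ hM hν hT i.2
        (Finset.mem_range.1 (Finset.mem_product.1 hi).1).le).trans (le_of_eq ?_))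
  rw [Finset.card_product, Finset.card_range, Finset.card_univ, Fintype.card_fin, nsmul_eq_mul]
  push_cast
  field_simp

/-! ### The expected regret -/

lemma IsRun.integrable_regret [IsProbabilityMeasure P] [IsProbabilityMeasure ν]
    (h : IsRun P ν γ κ T init r act) (hK : 1 ≤ K) (hν : ∀ᵐ x ∂ν, ∀ a, |x a| ≤ M) :
    Integrable (regret ν T act) P := by
  refine .of_bound (Measurable.aestronglyMeasurable ?_) (2 * M * T)
    (.of_forall fun ω => abs_regret_le hK hν ω)
  unfold regret
  exact Finset.measurable_fun_sum _ fun t ht => measurable_const.sub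
    ((measurable_of_finite (armMean ν)).comp (h.measurable_act t (Finset.mem_range.1 ht)))

lemma IsRun.ae_regret_le [IsProbabilityMeasure P] [IsProbabilityMeasure ν]
    (h : IsRun P ν γ (inflation γ M K) T init r act) (hγ₀ : 0 < γ) (hγ₁ : γ < 1) (hM : 0 < M)
    (hK : 1 ≤ K) (hν : ∀ᵐ x ∂ν, ∀ a, |x a| ≤ M) (hT : 600 ≤ T) :
    ∀ᵐ ω ∂P, ω ∉ badEvent P ν γ M T init r act → regret ν T act ω ≤
      2 * M + 2 * gapConst γ M * K ^ 2 * √(T * Real.log T) := by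
  obtain ⟨i, hi⟩ := exists_best_arm ν hK
  filter_upwards [h.ae_abs_le hν, h.ae_condProp_eq, h.ae_act_mem] with ω h1 h2 h3 hω
  rw [regret, ← hi]
  refine regret_le_of_deviation_le hγ₀ hγ₁ hM hT h1.1 (fun s hs => h1.2 s hs _)
    (abs_armMean_le hν) (fun n hn a => ?_)
    (fun a => hi ▸ le_ciSup (Set.finite_range _).bddAbove a) h3
  simp only [badEvent, Set.mem_iUnion, not_exists, Set.mem_ofPred_eq, not_lt] at hω
  -- `deviation` and the sum of increments agree once `condProp` is replaced by `propensity`.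
  refine le_of_eq_of_le (congrArg _ (Finset.sum_congr rfl fun s hs => ?_))
    (hω (n, a) (Finset.mem_product.2 ⟨Finset.mem_range.2 hn, Finset.mem_univ a⟩))
  rw [increment, h2 s ((Finset.mem_range.1 hs).trans hn) a]
  rfl

lemma IsRun.integral_regret_le [IsProbabilityMeasure P] [IsProbabilityMeasure ν]
    (h : IsRun P ν γ (inflation γ M K) T init r act) (hγ₀ : 0 < γ) (hγ₁ : γ < 1) (hM : 0 < M)
    (hK : 1 ≤ K) (hν : ∀ᵐ x ∂ν, ∀ a, |x a| ≤ M) (hT : 600 ≤ T) :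
    ∫ ω, regret ν T act ω ∂P ≤
      2 * M + 2 * gapConst γ M * K ^ 2 * √(T * Real.log T) + 4 * M * K := by
  have hT0 : (0 : ℝ) < T := by exact_mod_cast (by omega : 0 < T)
  have hbad := h.measurableSet_badEvent (M := M)
  set G := 2 * M + 2 * gapConst γ M * K ^ 2 * √(T * Real.log T)
  have hG : 0 ≤ G := by
    have : 0 ≤ gapConst γ M := by
      unfold gapConst
      positivity
    positivity
  have hint : Integrable ((badEvent P ν γ M T init r act).indicator fun _ => 2 * M * (T : ℝ)) P :=
    (integrable_const _).indicator hbad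
  calc _ ≤ ∫ ω, (G + (badEvent P ν γ M T init r act).indicator (fun _ => 2 * M * (T : ℝ)) ω) ∂P := by
        refine integral_mono_ae (h.integrable_regret hK hν) ((integrable_const G).add hint) ?_
        filter_upwards [h.ae_regret_le hγ₀ hγ₁ hM hK hν hT] with ω hω
        by_cases hmem : ω ∈ badEvent P ν γ M T init r act
        · simp only [Set.indicator_of_mem hmem]
          exact ((le_abs_self _).trans (abs_regret_le hK hν ω)).trans (le_add_of_nonneg_left hG)
        · simp only [Set.indicator_of_notMem hmem, add_zero]
          exact hω hmem
    _ = G + P.real (badEvent P ν γ M T init r act) * (2 * M * T) := by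
        rw [integral_add (integrable_const G) hint, integral_indicator_const _ hbad]
        simp
    _ ≤ G + 2 * K / T * (2 * M * T) := by
        gcongr
        exact h.measureReal_badEvent_le hγ₀ hγ₁ hM hν (by omega)
    _ = _ := by
        field_simp
        ring

end Run

end

end DATS

theorem theorem2 (γ M : ℝ) (hγ₀ : 0 < γ) (hγ₁ : γ < 1) (hM : 0 < M) :
    ∃ C : ℝ, ∀ (K T : ℕ), 1 ≤ K → 2 ≤ T →
      ∀ (ν : Measure (Fin K → ℝ)) [IsProbabilityMeasure ν], (∀ᵐ x ∂ν, ∀ a, |x a| ≤ M) →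
      ∀ (Ω : Type*) [MeasurableSpace Ω] (P : Measure Ω) [IsProbabilityMeasure P]
        (init : Ω → Fin K → ℝ) (r : ℕ → Ω → Fin K → ℝ) (act : ℕ → Ω → Fin K),
      DATS.IsRun P ν γ (DATS.inflation γ M K) T init r act →
        Integrable (DATS.regret ν T act) P ∧
          ∫ ω, DATS.regret ν T act ω ∂P ≤ C * (K : ℝ) ^ 2 * √((T : ℝ) * Real.log T) := by
  -- `1200 M` covers the trivial regret `2 M T` for `T < 600`; for larger `T` it absorbs the
  -- lower-order terms `2 M + 4 M K`, as `√(T log T) ≥ 1`.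
  refine ⟨1200 * M + 2 * DATS.gapConst γ M, ?_⟩
  intro K T hK hT ν _ hν Ω _ P _ init r act h
  refine ⟨h.integrable_regret hK hν, ?_⟩
  have hC : 0 ≤ DATS.gapConst γ M := by
    unfold DATS.gapConst
    positivity
  have hK' : (1 : ℝ) ≤ K := by exact_mod_cast hK
  have hT' : (2 : ℝ) ≤ T := by exact_mod_cast hT
  have hX : 1 ≤ √((T : ℝ) * Real.log T) := by
    rw [Real.one_le_sqrt]
    have := Real.log_le_log (by norm_num) hT'
    nlinarith [Real.log_two_gt_d9]
  set X := √((T : ℝ) * Real.log T)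
  have hK2 : (K : ℝ) ≤ K ^ 2 := by nlinarith
  have hMK : M ≤ M * K := le_mul_of_one_le_right hM.le hK'
  have hMK2 : M * K ≤ M * K ^ 2 := by gcongr
  have hMKX : M * K ^ 2 ≤ M * K ^ 2 * X := le_mul_of_one_le_right (by positivity) hX
  have hCX : 0 ≤ DATS.gapConst γ M * K ^ 2 * X := by positivity
  rw [add_mul, add_mul]
  rcases lt_or_ge T 600 with hsmall | hlarge
  · have h1 : ∫ ω, DATS.regret ν T act ω ∂P ≤ 2 * M * T := by
      have := integral_mono (h.integrable_regret hK hν) (integrable_const (2 * M * (T : ℝ)))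
        fun ω => (le_abs_self _).trans (DATS.abs_regret_le (T := T) (act := act) hK hν ω)
      simpa using this
    have h2 : (T : ℝ) ≤ 600 := by exact_mod_cast hsmall.le
    have h3 : M * T ≤ M * 600 := by gcongr
    linarith
  · have h1 := h.integral_regret_le hγ₀ hγ₁ hM hK hν hlarge
    linarith
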